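/- Let $d\in\{2,3\}$, $n\ge 1$ and $k\ge 0$ be integers. Let $T\subset\mathbb R^d$ be a convex polygon ($d=2$) or convex polyhedron ($d=3$) with nonempty interior, with exactly $n$ edges/faces $e_1,\dots,e_n$ (the facets of $T$), diameter $h_T$, and face diameters $h_{e_i}$; let $\mathbf n$ be the outward unit normal on $e_1$ and $\mathbf m_1$ the barycenter of $e_1$. For a set $K$ let $P_k(K)$ be the polynomials of total degree at most $k$ restricted to $K$, with $P_{-1}(K)=\{0\}$; let $(\cdot,\cdot)_T$ and $\langle\cdot,\cdot\rangle_{e_1}$ be the $L^2$ inner products on $T$ and (with respect to surface measure) on $e_1$, with norms $\|\cdot\|_T$ and $\|\cdot\|_{e_1}$. Let $\lambda_1\in P_1(T)$ satisfy $\lambda_1|_{e_1}=0$, $\max_T\lambda_1=1$, and for $i>1$ let $\lambda_i\in P_1(T)$ satisfy $\lambda_i|_{e_i}=0$, $\lambda_i(\mathbf m_1)=1$. (a) For every $f\in P_k(e_1)$ there is a unique polynomial $q$ of the form $q=\lambda_1\lambda_2^2\cdots\lambda_n^2\,q_k$ with $q_k\in P_k(T)$ such that $$(q,p)_T=0\quad\forall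 p\in P_{k-1}(T),\qquad \langle\nabla q\cdot\mathbf n-f,\;p\rangle_{e_1}=0\quad\forall p\in P_k(e_1).$$ (b) For all $\alpha_0,\rho,\sigma>0$ there is a constant $C>0$ depending only on $d,n,k,\alpha_0,\rho,\sigma$ such that $$\|q\|_T\le C\,h_T^{3/2}\,\|f\|_{e_1}$$ for every such $T$, every $f\in P_k(e_1)$ and the corresponding $q$, provided that: (i) for every face $e_i$ neighboring $e_1$ (sharing a vertex with it if $d=2$, a one-dimensional edge if $d=3$), the interior angle between $e_1$ and $e_i$ lies in $[\alpha_0,\pi-\alpha_0]$; (ii) $h_{e_i}\ge\rho\,h_T$ for all $i$; (iii) if $d=3$, the distance from $\mathbf m_1$ to $e_1\cap e_i$ is at least $\sigma\,h_{e_1}$ for every neighboring face $e_i$. -/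

import Mathlib

open MeasureTheory

noncomputable section

/-- A convex polytope with nonempty interior in `ℝ^d` (a convex polygon for `d = 2`, a convex
polyhedron for `d = 3`) with exactly `n` facets (edges for `d = 2`, flat faces for `d = 3`): a
bounded intersection of `n` closed half-spaces `⟪ν i, x⟫ ≤ c i`, such that every bounding hyperplane
cuts out a `(d-1)`-dimensional facet and distinct indices give distinct facets. The vector `ν i` is
the outward unit normal on the `i`-th facet. -/
structure ConvexPolytope (d n : ℕ) where
  normal : Fin n → EuclideanSpace ℝ (Fin d)
  offset : Fin n → ℝ
  norm_normal : ∀ i, ‖normal i‖ = 1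
  isBounded : Bornology.IsBounded {x | ∀ i, inner ℝ (normal i) x ≤ offset i}
  interior_nonempty : (interior {x | ∀ i, inner ℝ (normal i) x ≤ offset i}).Nonempty
  finrank_facet : ∀ j, Module.finrank ℝ
    (affineSpan ℝ {x | (∀ i, inner ℝ (normal i) x ≤ offset i) ∧
      inner ℝ (normal j) x = offset j}).direction = d - 1
  facet_injective : Function.Injective fun j =>
    {x | (∀ i, inner ℝ (normal i) x ≤ offset i) ∧ inner ℝ (normal j) x = offset j}

namespace ConvexPolytope

variable {d n : ℕ}

/-- The polytope as a set of points. -/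
def carrier (T : ConvexPolytope d n) : Set (EuclideanSpace ℝ (Fin d)) :=
  {x | ∀ i, inner ℝ (T.normal i) x ≤ T.offset i}

/-- The `j`-th facet `e_j`. -/
def facet (T : ConvexPolytope d n) (j : Fin n) : Set (EuclideanSpace ℝ (Fin d)) :=
  {x | x ∈ T.carrier ∧ inner ℝ (T.normal j) x = T.offset j}

/-- Surface measure on the `j`-th facet (arc length for `d = 2`, area for `d = 3`). -/
def surface (T : ConvexPolytope d n) (j : Fin n) : Measure (EuclideanSpace ℝ (Fin d)) :=
  μHE[d - 1].restrict (T.facet j)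

/-- The barycenter of the `j`-th facet. -/
def barycenter (T : ConvexPolytope d n) (j : Fin n) : EuclideanSpace ℝ (Fin d) :=
  ⨍ x, x ∂(T.surface j)

/-- `e_i` is a neighbor of `e_j`: they are distinct and share a common vertex (`d = 2`) or a common
one-dimensional edge (`d = 3`). -/
def IsNeighbor (T : ConvexPolytope d n) (j i : Fin n) : Prop :=
  i ≠ j ∧ (T.facet j ∩ T.facet i).Nonempty ∧
    Module.finrank ℝ (affineSpan ℝ (T.facet j ∩ T.facet i)).direction = d - 2

/-- Shape regularity of `T` relative to its facet `e_j`, with parameters `α₀`, `ρ`, `σ`: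
* the interior angle `π - α_i` between `e_j` and any neighbor `e_i` satisfies
  `α₀ ≤ α_i ≤ π - α₀` (`α_i` is the angle between the outward normals);
* every facet has diameter at least `ρ * diam T`;
* if `d = 3`, the distance from the barycenter of `e_j` to each of the edges `e_j ∩ e_i` is at least
  `σ * diam e_j`. -/
structure IsShapeRegular (T : ConvexPolytope d n) (j : Fin n) (α₀ ρ σ : ℝ) : Prop where
  angle_le : ∀ i, T.IsNeighbor j i →
    α₀ ≤ InnerProductGeometry.angle (T.normal j) (T.normal i) ∧
      InnerProductGeometry.angle (T.normal j) (T.normal i) ≤ Real.pi - α₀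
  ratio_le : ∀ i, ρ * Metric.diam T.carrier ≤ Metric.diam (T.facet i)
  dist_le : d = 3 → ∀ i, T.IsNeighbor j i →
    σ * Metric.diam (T.facet j) ≤ Metric.infDist (T.barycenter j) (T.facet j ∩ T.facet i)

end ConvexPolytope

/-- The value of the polynomial `p` at the point `x` of `ℝ^d`. -/
def polyVal {d : ℕ} (p : MvPolynomial (Fin d) ℝ) (x : EuclideanSpace ℝ (Fin d)) : ℝ :=
  MvPolynomial.eval (fun a => x a) p

/-- The directional derivative `∇p · v` at `x`. -/
def polyDeriv {d : ℕ} (p : MvPolynomial (Fin d) ℝ) (v x : EuclideanSpace ℝ (Fin d)) : ℝ :=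
  ∑ a, polyVal (MvPolynomial.pderiv a p) x * v a

/-- The `L²` norm of a polynomial with respect to the measure `μ`. -/
def polyL2Norm {d : ℕ} (μ : Measure (EuclideanSpace ℝ (Fin d))) (p : MvPolynomial (Fin d) ℝ) : ℝ :=
  Real.sqrt (∫ x, polyVal p x ^ 2 ∂μ)

/-- The weights: `l i` is an affine function vanishing on `e_i`; the one belonging to the
distinguished facet `e_j` has maximum `1` over `T`, the others take the value `1` at the barycenter
of `e_j`. -/
structure IsFacetWeights {d n : ℕ} (T : ConvexPolytope d n) (j : Fin n)
    (l : Fin n → MvPolynomial (Fin d) ℝ) : Prop where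
  totalDegree_le : ∀ i, (l i).totalDegree ≤ 1
  vanish : ∀ i, ∀ x ∈ T.facet i, polyVal (l i) x = 0
  max_eq_one : IsGreatest (polyVal (l j) '' T.carrier) 1
  barycenter_eq_one : ∀ i, i ≠ j → polyVal (l i) (T.barycenter j) = 1

/-- `q = λ_j (∏_{i ≠ j} λ_i²) q_k` with `q_k ∈ P_k(T)`, `(q, p)_T = 0` for all `p ∈ P_{k-1}(T)`
(with `P_{-1}(T) = {0}`), and `⟨∇q · n - f, p⟩_{e_j} = 0` for all `p ∈ P_k(e_j)`. -/
structure IsBubbleSolution {d n : ℕ} (T : ConvexPolytope d n) (j : Fin n)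
    (l : Fin n → MvPolynomial (Fin d) ℝ) (k : ℕ) (f q : MvPolynomial (Fin d) ℝ) : Prop where
  factor : ∃ r : MvPolynomial (Fin d) ℝ, r.totalDegree ≤ k ∧
    q = l j * (∏ i ∈ Finset.univ.erase j, l i ^ 2) * r
  orthogonal : ∀ p : MvPolynomial (Fin d) ℝ, p.totalDegree < k →
    ∫ x in T.carrier, polyVal q x * polyVal p x = 0
  normal_trace : ∀ p : MvPolynomial (Fin d) ℝ, p.totalDegree ≤ k →
    ∫ x, (polyDeriv q (T.normal j) x - polyVal f x) * polyVal p x ∂(T.surface j) = 0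

end

/-! Write `b` for the product of the `λ_i²` with `i ≠ j`, and `λ_j = κ · gap_j`, where `gap_j` is
the distance to the hyperplane of `e_j`, positive inside `T`. For `q = λ_j b r`, the product rule on
`e_j` gives `∇q · n = -κ b r`. The trace condition thus says that `r` represents `-f/κ` on
`P_k(e_j)` in the `b`-weighted `L²` product of `e_j`. Split `r = r₀ + λ_j s` with `r₀` constant
along the normal: the trace condition determines `r₀`, and orthogonality to `P_{k-1}(T)` determines
`s` through the inner product on `T` with weight `λ_j² b`. Both weights are positive on a relatively
open set, so both problems are uniquely solvable.

The estimate needs no compactness over shapes of `T`. Put `h = diam T`. Shape regularity supplies a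
disk in `e_j` about the barycenter `m`, of radius `c h`, and a bound `λ_i ≤ A` on `T` for `i ≠ j`
(`gap_le_mul_gap`). On the half-size disk `λ_i ≥ 1/2`, so equivalence of norms on polynomials over a
fixed ball, after scaling, controls `r` pointwise by `Q = ∫_{e_j} b r²`. Testing the trace condition
with `r` and using `κ h ≥ 1` gives `Q ≲ h² ‖f‖²`. Next `R = ∫_T b r₀² ≲ h Q`. Testing orthogonality
with `s` gives `N = ∫_T λ_j² b s² ≤ R`, because `∫_T b (r₀ + λ_j s)² = R - N`. Since `b` is bounded
and `0 ≤ λ_j ≤ 1` on `T`, `‖q‖² ≲ R + N ≲ h³ ‖f‖²` (`IsBubbleSolution.integral_sq_le`). -/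

/-! ### Polynomials as functions on Euclidean space -/

section PolyVal

variable {d : ℕ}

@[simp] lemma polyVal_add (p q : MvPolynomial (Fin d) ℝ) (x) :
    polyVal (p + q) x = polyVal p x + polyVal q x := by simp [polyVal]

@[simp] lemma polyVal_sub (p q : MvPolynomial (Fin d) ℝ) (x) :
    polyVal (p - q) x = polyVal p x - polyVal q x := by simp [polyVal]

@[simp] lemma polyVal_mul (p q : MvPolynomial (Fin d) ℝ) (x) :
    polyVal (p * q) x = polyVal p x * polyVal q x := by simp [polyVal]

@[simp] lemma polyVal_pow (p : MvPolynomial (Fin d) ℝ) (n : ℕ) (x) :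
    polyVal (p ^ n) x = polyVal p x ^ n := by simp [polyVal]

@[simp] lemma polyVal_zero (x : EuclideanSpace ℝ (Fin d)) : polyVal 0 x = 0 := by simp [polyVal]

@[simp] lemma polyVal_smul (c : ℝ) (p : MvPolynomial (Fin d) ℝ) (x) :
    polyVal (c • p) x = c * polyVal p x := by simp [polyVal, MvPolynomial.smul_eval]

@[simp] lemma polyVal_C (c : ℝ) (x : EuclideanSpace ℝ (Fin d)) :
    polyVal (MvPolynomial.C c) x = c := by simp [polyVal]

@[simp] lemma polyVal_X (a : Fin d) (x : EuclideanSpace ℝ (Fin d)) :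
    polyVal (MvPolynomial.X a) x = x a := by simp [polyVal]

@[simp] lemma polyVal_sum {ι : Type*} (s : Finset ι) (f : ι → MvPolynomial (Fin d) ℝ) (x) :
    polyVal (∑ i ∈ s, f i) x = ∑ i ∈ s, polyVal (f i) x := by simp [polyVal]

@[simp] lemma polyVal_prod {ι : Type*} (s : Finset ι) (f : ι → MvPolynomial (Fin d) ℝ) (x) :
    polyVal (∏ i ∈ s, f i) x = ∏ i ∈ s, polyVal (f i) x := by
  simp [polyVal, map_prod]

lemma polyVal_injective {p q : MvPolynomial (Fin d) ℝ} (h : ∀ x, polyVal p x = polyVal q x) :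
    p = q :=
  MvPolynomial.funext fun x => h (WithLp.toLp 2 x)

@[fun_prop] lemma continuous_polyVal (p : MvPolynomial (Fin d) ℝ) : Continuous (polyVal p) := by
  unfold polyVal
  exact (MvPolynomial.continuous_eval p).comp (by fun_prop)

lemma analyticOnNhd_polyVal (p : MvPolynomial (Fin d) ℝ) :
    AnalyticOnNhd ℝ (polyVal p) Set.univ := by
  have h := AnalyticOnNhd.aeval_mvPolynomial (𝕜 := ℝ) (B := ℝ)
    (f := fun (x : EuclideanSpace ℝ (Fin d)) (a : Fin d) => x a) (s := Set.univ)
    (fun a => (EuclideanSpace.proj a : EuclideanSpace ℝ (Fin d) →L[ℝ] ℝ).analyticOnNhd _) p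
  exact h

lemma eq_zero_of_polyVal_eq_zero_on {p : MvPolynomial (Fin d) ℝ}
    {U : Set (EuclideanSpace ℝ (Fin d))} (hU : IsOpen U) (hne : U.Nonempty)
    (h : ∀ x ∈ U, polyVal p x = 0) : p = 0 := by
  obtain ⟨z, hz⟩ := hne
  have := AnalyticOnNhd.eq_of_eventuallyEq (analyticOnNhd_polyVal p) (analyticOnNhd_polyVal 0)
    (z₀ := z) (by
      filter_upwards [hU.mem_nhds hz] with x hx
      simp [h x hx])
  exact polyVal_injective fun x => congrFun this x

lemma totalDegree_bind₁_le {e : ℕ} (θ : Fin d → MvPolynomial (Fin e) ℝ)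
    (hθ : ∀ a, (θ a).totalDegree ≤ 1) (p : MvPolynomial (Fin d) ℝ) :
    (MvPolynomial.bind₁ θ p).totalDegree ≤ p.totalDegree := by
  conv_lhs => rw [p.as_sum]
  rw [map_sum]
  refine MvPolynomial.totalDegree_finsetSum_le fun m hm => ?_
  rw [MvPolynomial.bind₁_monomial]
  refine (MvPolynomial.totalDegree_mul _ _).trans ?_
  rw [MvPolynomial.totalDegree_C, zero_add]
  refine (MvPolynomial.totalDegree_finsetProd _ _).trans ?_
  refine le_trans ?_ (MvPolynomial.le_totalDegree hm)
  refine Finset.sum_le_sum fun a _ => ?_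
  refine (MvPolynomial.totalDegree_pow _ _).trans ?_
  simpa using Nat.mul_le_mul_left (m a) (hθ a)

/-- The affine polynomial with constant term `c` and linear part `⟪w, x⟫`. -/
noncomputable def affinePoly (c : ℝ) (w : EuclideanSpace ℝ (Fin d)) : MvPolynomial (Fin d) ℝ :=
  MvPolynomial.C c + ∑ a, MvPolynomial.C (w a) * MvPolynomial.X a

lemma polyVal_affinePoly (c : ℝ) (w x : EuclideanSpace ℝ (Fin d)) :
    polyVal (affinePoly c w) x = c + inner ℝ w x := by
  simp [affinePoly, PiLp.inner_apply, mul_comm]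

lemma totalDegree_affinePoly (c : ℝ) (w : EuclideanSpace ℝ (Fin d)) :
    (affinePoly c w).totalDegree ≤ 1 := by
  refine (MvPolynomial.totalDegree_add _ _).trans (max_le (by simp) ?_)
  refine MvPolynomial.totalDegree_finsetSum_le fun a _ => ?_
  refine (MvPolynomial.totalDegree_mul _ _).trans ?_
  simp

lemma polyDeriv_affinePoly (c : ℝ) (w v x : EuclideanSpace ℝ (Fin d)) :
    polyDeriv (affinePoly c w) v x = inner ℝ w v := by
  simp [polyDeriv, affinePoly, PiLp.inner_apply, mul_comm, MvPolynomial.pderiv_X, Pi.single_apply]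

lemma polyDeriv_mul (p q : MvPolynomial (Fin d) ℝ) (v x : EuclideanSpace ℝ (Fin d)) :
    polyDeriv (p * q) v x = polyDeriv p v x * polyVal q x + polyVal p x * polyDeriv q v x := by
  simp only [polyDeriv, Derivation.leibniz, polyVal_add, smul_eq_mul, polyVal_mul, Finset.sum_mul,
    Finset.mul_sum, ← Finset.sum_add_distrib]
  exact Finset.sum_congr rfl fun a _ => by ring

lemma exists_eq_affinePoly {p : MvPolynomial (Fin d) ℝ} (hp : p.totalDegree ≤ 1) :
    ∃ c w, p = affinePoly c w := by
  classical
  have hadd : ∀ p q : MvPolynomial (Fin d) ℝ, (∃ c w, p = affinePoly c w) →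
      (∃ c w, q = affinePoly c w) → ∃ c w, p + q = affinePoly c w := by
    rintro _ _ ⟨c, w, rfl⟩ ⟨c', w', rfl⟩
    exact ⟨c + c', w + w', polyVal_injective fun x => by
      simp only [polyVal_add, polyVal_affinePoly, inner_add_left]; ring⟩
  rw [p.as_sum]
  refine Finset.sum_induction _ (fun q => ∃ c w, q = affinePoly c w) hadd
    ⟨0, 0, polyVal_injective fun x => by simp [polyVal_affinePoly]⟩ fun m hm => ?_
  have hm1 : m.degree ≤ 1 := (MvPolynomial.le_totalDegree hm).trans hp
  rcases Nat.le_one_iff_eq_zero_or_eq_one.1 hm1 with h0 | h1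
  · rw [Finsupp.degree_eq_zero_iff] at h0
    subst h0
    exact ⟨MvPolynomial.coeff 0 p, 0, polyVal_injective fun x => by simp [affinePoly]⟩
  · obtain ⟨a, rfl⟩ := (Finsupp.sum_eq_one_iff m).1 h1
    refine ⟨0, EuclideanSpace.single a (MvPolynomial.coeff (Finsupp.single a 1) p),
      polyVal_injective fun x => ?_⟩
    rw [polyVal_affinePoly]
    simp [polyVal, MvPolynomial.eval_monomial, EuclideanSpace.inner_single_left]

/-- Composition of a polynomial with an affine map is a polynomial of no larger degree. -/
lemma exists_polyVal_comp_affine {e : ℕ} (m : EuclideanSpace ℝ (Fin d))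
    (A : EuclideanSpace ℝ (Fin e) →ₗ[ℝ] EuclideanSpace ℝ (Fin d)) (p : MvPolynomial (Fin d) ℝ) :
    ∃ q : MvPolynomial (Fin e) ℝ, q.totalDegree ≤ p.totalDegree ∧
      ∀ y, polyVal q y = polyVal p (m + A y) := by
  have key : ∀ a : Fin d, ∃ θ : MvPolynomial (Fin e) ℝ, θ.totalDegree ≤ 1 ∧
      ∀ y, polyVal θ y = (m + A y) a := by
    intro a
    -- The `a`-th coordinate of `A y` is `⟪e_a, A y⟫ = ⟪A* e_a, y⟫`.
    refine ⟨affinePoly (m a) (LinearMap.adjoint A (EuclideanSpace.single a 1)),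
      totalDegree_affinePoly _ _, fun y => ?_⟩
    rw [polyVal_affinePoly, LinearMap.adjoint_inner_left, EuclideanSpace.inner_single_left]
    simp
  choose θ hθ hθv using key
  refine ⟨MvPolynomial.bind₁ θ p, totalDegree_bind₁_le θ hθ p, fun y => ?_⟩
  have : ∀ f : Fin d → ℝ, (fun a => polyVal (θ a) y) = f →
      polyVal (MvPolynomial.bind₁ θ p) y = MvPolynomial.eval f p := by
    rintro f rfl
    exact MvPolynomial.eval₂Hom_bind₁ _ _ _ _
  exact this _ (funext fun a => hθv a y)

end PolyVal

/-! ### Division with remainder by an affine polynomial -/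

section Division

variable {d : ℕ}

lemma degreeLT_add {p q : MvPolynomial (Fin d) ℝ} {N : ℕ} (hp : p = 0 ∨ p.totalDegree < N)
    (hq : q = 0 ∨ q.totalDegree < N) : p + q = 0 ∨ (p + q).totalDegree < N := by
  rcases hp with rfl | hp
  · simpa using hq
  rcases hq with rfl | hq
  · simpa using Or.inr hp
  · exact Or.inr ((MvPolynomial.totalDegree_add p q).trans_lt (max_lt hp hq))

/-- Induction on the degree. Write `θ` also for the substitution `X_i ↦ X_i + t_i l`. If `m' - θ(m')
= l s`, then `X_i m' - θ(X_i m') = l (X_i s - t_i θ(m'))`. Tracking one monomial at a time shows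
that the quotient loses a degree. -/
lemma exists_monomial_sub_bind₁_eq_mul {l : MvPolynomial (Fin d) ℝ} (hl : l.totalDegree ≤ 1)
    (t : Fin d → ℝ) (N : ℕ) : ∀ (m : Fin d →₀ ℕ) (a : ℝ), m.degree = N →
    ∃ s : MvPolynomial (Fin d) ℝ, (s = 0 ∨ s.totalDegree < N) ∧
      MvPolynomial.monomial m a - MvPolynomial.bind₁
        (fun i => MvPolynomial.X i + MvPolynomial.C (t i) * l) (MvPolynomial.monomial m a)
        = l * s := by
  set θ : Fin d → MvPolynomial (Fin d) ℝ := fun i => MvPolynomial.X i + MvPolynomial.C (t i) * l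
  have hθ : ∀ i, (θ i).totalDegree ≤ 1 := fun i =>
    (MvPolynomial.totalDegree_add _ _).trans (max_le (by simp)
      ((MvPolynomial.totalDegree_mul _ _).trans (by simpa using hl)))
  induction N with
  | zero =>
    intro m a hm
    rw [Finsupp.degree_eq_zero_iff] at hm
    subst hm
    exact ⟨0, Or.inl rfl, by simp [MvPolynomial.monomial_zero']⟩
  | succ N ih =>
    intro m a hm
    obtain ⟨i, hi⟩ : ∃ i, m i ≠ 0 := by
      by_contra! h
      have : m = 0 := Finsupp.ext h
      simp [this] at hm
    obtain ⟨m', rfl⟩ : ∃ m', m = Finsupp.single i 1 + m' :=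
      le_iff_exists_add.1 (Finsupp.single_le_iff.2 (Nat.one_le_iff_ne_zero.2 hi))
    have hm' : m'.degree = N := by
      rw [map_add, Finsupp.degree_single] at hm; omega
    obtain ⟨s, hs, hsl⟩ := ih m' a hm'
    have hmon : MvPolynomial.monomial (Finsupp.single i 1 + m') a
        = MvPolynomial.X i * MvPolynomial.monomial m' a := by
      rw [MvPolynomial.X, MvPolynomial.monomial_mul, one_mul]
    refine ⟨MvPolynomial.X i * s + MvPolynomial.C (-t i) *
      MvPolynomial.bind₁ θ (MvPolynomial.monomial m' a), degreeLT_add ?_ (Or.inr ?_), ?_⟩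
    · rcases hs with rfl | hs
      · exact Or.inl (by simp)
      · refine Or.inr ((MvPolynomial.totalDegree_mul _ _).trans_lt ?_)
        rw [MvPolynomial.totalDegree_X]; omega
    · refine (MvPolynomial.totalDegree_mul _ _).trans_lt ?_
      rw [MvPolynomial.totalDegree_C, zero_add, Nat.lt_succ_iff]
      refine (totalDegree_bind₁_le θ hθ _).trans ?_
      exact (MvPolynomial.totalDegree_monomial_le _ _).trans hm'.le
    · rw [hmon, map_mul, MvPolynomial.bind₁_X_right]
      have : MvPolynomial.monomial m' a
          = l * s + MvPolynomial.bind₁ θ (MvPolynomial.monomial m' a) := by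
        rw [← hsl]; ring
      generalize MvPolynomial.bind₁ θ (MvPolynomial.monomial m' a) = R at *
      rw [this, map_neg]
      simp only [θ]
      ring

/-- Division with remainder by an affine polynomial `l`: the remainder is the composition of `p`
with the map `x ↦ x + l(x) t`. -/
lemma exists_eq_add_affine_mul {l : MvPolynomial (Fin d) ℝ} (hl : l.totalDegree ≤ 1)
    (t : EuclideanSpace ℝ (Fin d)) (p : MvPolynomial (Fin d) ℝ) :
    ∃ p₀ s : MvPolynomial (Fin d) ℝ, p₀.totalDegree ≤ p.totalDegree ∧
      (s = 0 ∨ s.totalDegree < p.totalDegree) ∧ p = p₀ + l * s ∧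
      ∀ x, polyVal p₀ x = polyVal p (x + polyVal l x • t) := by
  set θ : Fin d → MvPolynomial (Fin d) ℝ := fun i => MvPolynomial.X i + MvPolynomial.C (t i) * l
    with hθdef
  have hθ : ∀ i, (θ i).totalDegree ≤ 1 := fun i =>
    (MvPolynomial.totalDegree_add _ _).trans (max_le (by simp)
      ((MvPolynomial.totalDegree_mul _ _).trans (by simpa using hl)))
  obtain ⟨s, hs, hsl⟩ : ∃ s : MvPolynomial (Fin d) ℝ, (s = 0 ∨ s.totalDegree < p.totalDegree) ∧
      p - MvPolynomial.bind₁ θ p = l * s := by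
    have h : ∀ m ∈ p.support, ∃ s : MvPolynomial (Fin d) ℝ,
        (s = 0 ∨ s.totalDegree < p.totalDegree) ∧
        MvPolynomial.monomial m (p.coeff m) -
          MvPolynomial.bind₁ θ (MvPolynomial.monomial m (p.coeff m)) = l * s := by
      intro m hm
      obtain ⟨s, hs, hsl⟩ := exists_monomial_sub_bind₁_eq_mul hl t _ m (p.coeff m) rfl
      exact ⟨s, hs.imp id fun h => h.trans_le (MvPolynomial.le_totalDegree hm), hsl⟩
    generalize p.totalDegree = N at h ⊢
    rw [p.as_sum, map_sum, ← Finset.sum_sub_distrib]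
    refine Finset.sum_induction _
      (fun q => ∃ s : MvPolynomial (Fin d) ℝ, (s = 0 ∨ s.totalDegree < N) ∧ q = l * s)
      ?_ ⟨0, Or.inl rfl, by simp⟩ h
    rintro _ _ ⟨s, hs, rfl⟩ ⟨s', hs', rfl⟩
    exact ⟨s + s', degreeLT_add hs hs', by ring⟩
  refine ⟨MvPolynomial.bind₁ θ p, s, totalDegree_bind₁_le θ hθ p, hs, by rw [← hsl]; ring,
    fun x => ?_⟩
  have : ∀ f : Fin d → ℝ, (fun a => polyVal (θ a) x) = f →
      polyVal (MvPolynomial.bind₁ θ p) x = MvPolynomial.eval f p := by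
    rintro f rfl
    exact MvPolynomial.eval₂Hom_bind₁ _ _ _ _
  exact this _ (funext fun a => by simp [hθdef, mul_comm])

end Division

/-! ### Riesz representation and equivalence of norms on polynomials -/

section Riesz

variable {d : ℕ}

/-- A Riesz theorem for possibly degenerate forms: the hypothesis makes `Φ` vanish on the radical of
`B`, and the functionals that do so are exactly those of the form `B u`. Degeneracy has to be
allowed because polynomials in `d` variables that vanish on a facet are null for its `L²` product.
-/
lemma exists_apply_eq_of_apply_self_eq_zero {V : Type*} [AddCommGroup V] [Module ℝ V]
    [FiniteDimensional ℝ V] (B : V →ₗ[ℝ] V →ₗ[ℝ] ℝ) (hB : ∀ u v, B u v = B v u)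
    (Φ : V →ₗ[ℝ] ℝ) (h : ∀ v, B v v = 0 → Φ v = 0) : ∃ u, ∀ v, B u v = Φ v := by
  have hmem : Φ ∈ (LinearMap.ker B).dualAnnihilator := by
    rw [Submodule.mem_dualAnnihilator]
    intro v hv
    exact h v (by rw [LinearMap.mem_ker.1 hv]; rfl)
  rw [← LinearMap.range_dualMap_eq_dualAnnihilator_ker] at hmem
  obtain ⟨Ψ, hΨ⟩ := hmem
  obtain ⟨u, rfl⟩ := (Module.evalEquiv ℝ V).surjective Ψ
  refine ⟨u, fun v => ?_⟩
  rw [← hΨ, hB u v]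
  simp

/-- A linear functional on the polynomials of degree at most `k` is represented by a weighted `L²`
inner product as soon as it vanishes on the kernel of the latter. -/
lemma exists_integral_mul_eq {μ : Measure (EuclideanSpace ℝ (Fin d))}
    (hμ : ∀ g : EuclideanSpace ℝ (Fin d) → ℝ, Continuous g → Integrable g μ)
    {w : EuclideanSpace ℝ (Fin d) → ℝ} (hw : Continuous w) (k : ℕ)
    (Φ : MvPolynomial (Fin d) ℝ →ₗ[ℝ] ℝ)
    (h : ∀ p : MvPolynomial (Fin d) ℝ, p.totalDegree ≤ k → ∫ x, w x * polyVal p x ^ 2 ∂μ = 0 →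
      Φ p = 0) :
    ∃ u : MvPolynomial (Fin d) ℝ, u.totalDegree ≤ k ∧
      ∀ p : MvPolynomial (Fin d) ℝ, p.totalDegree ≤ k →
        ∫ x, w x * (polyVal u x * polyVal p x) ∂μ = Φ p := by
  have hint : ∀ p q : MvPolynomial (Fin d) ℝ,
      Integrable (fun x => w x * (polyVal p x * polyVal q x)) μ := fun p q => hμ _ (by fun_prop)
  let B : MvPolynomial (Fin d) ℝ →ₗ[ℝ] MvPolynomial (Fin d) ℝ →ₗ[ℝ] ℝ :=
    LinearMap.mk₂ ℝ (fun p q => ∫ x, w x * (polyVal p x * polyVal q x) ∂μ)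
      (fun p p' q => by
        rw [← integral_add (hint _ _) (hint _ _)]
        exact integral_congr_ae (.of_forall fun x => by simp only [polyVal_add]; ring))
      (fun c p q => by
        rw [smul_eq_mul, ← integral_const_mul]
        exact integral_congr_ae (.of_forall fun x => by simp only [polyVal_smul]; ring))
      (fun p q q' => by
        rw [← integral_add (hint _ _) (hint _ _)]
        exact integral_congr_ae (.of_forall fun x => by simp only [polyVal_add]; ring))
      (fun c p q => by
        rw [smul_eq_mul, ← integral_const_mul]
        exact integral_congr_ae (.of_forall fun x => by simp only [polyVal_smul]; ring))
  let V := MvPolynomial.restrictTotalDegree (Fin d) ℝ k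
  obtain ⟨u, hu⟩ := exists_apply_eq_of_apply_self_eq_zero (V := V)
    (B.compl₁₂ V.subtype V.subtype)
    (fun u v => by
      simp only [LinearMap.compl₁₂_apply, B, LinearMap.mk₂_apply]
      exact integral_congr_ae (.of_forall fun x => by ring))
    (Φ.comp V.subtype)
    (fun v hv => by
      refine h v.1 ((MvPolynomial.mem_restrictTotalDegree _ _ _).1 v.2) ?_
      rw [← hv]
      simp only [LinearMap.compl₁₂_apply, B, LinearMap.mk₂_apply]
      exact integral_congr_ae (.of_forall fun x => by simp only [Submodule.subtype_apply]; ring))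
  refine ⟨u.1, (MvPolynomial.mem_restrictTotalDegree _ _ _).1 u.2, fun p hp => ?_⟩
  exact hu ⟨p, (MvPolynomial.mem_restrictTotalDegree _ _ _).2 hp⟩

lemma sq_integral_mul_le {α : Type*} [MeasurableSpace α] {μ : Measure α} {f g : α → ℝ}
    (hf : Integrable (fun x => f x ^ 2) μ) (hg : Integrable (fun x => g x ^ 2) μ)
    (hfg : Integrable (fun x => f x * g x) μ) :
    (∫ x, f x * g x ∂μ) ^ 2 ≤ (∫ x, f x ^ 2 ∂μ) * ∫ x, g x ^ 2 ∂μ := by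
  have h : ∀ t : ℝ, 0 ≤ (∫ x, g x ^ 2 ∂μ) * (t * t) + (2 * ∫ x, f x * g x ∂μ) * t
      + ∫ x, f x ^ 2 ∂μ := by
    intro t
    have : ∫ x, (f x + t * g x) ^ 2 ∂μ = (∫ x, g x ^ 2 ∂μ) * (t * t)
        + (2 * ∫ x, f x * g x ∂μ) * t + ∫ x, f x ^ 2 ∂μ := by
      rw [← integral_mul_const, ← integral_const_mul, ← integral_mul_const,
        ← integral_add (hg.mul_const _) ((hfg.const_mul _).mul_const _), ← integral_add]
      · exact integral_congr_ae (.of_forall fun x => by ring)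
      · exact (hg.mul_const _).add ((hfg.const_mul _).mul_const _)
      · exact hf
    rw [← this]
    exact integral_nonneg fun x => sq_nonneg _
  have := discrim_le_zero h
  rw [discrim] at this
  linarith

/-- The integrand is continuous, nonnegative and a.e. zero, hence zero on `U`; there `w > 0`, so `p`
vanishes on a nonempty open set. -/
lemma eq_zero_of_setIntegral_mul_sq_eq_zero {s U : Set (EuclideanSpace ℝ (Fin d))}
    (hs : IsCompact s) (hU : IsOpen U) (hne : U.Nonempty) (hUs : U ⊆ s)
    {w : EuclideanSpace ℝ (Fin d) → ℝ} (hw : Continuous w) (hw0 : ∀ x ∈ s, 0 ≤ w x)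
    (hwU : ∀ x ∈ U, 0 < w x) {p : MvPolynomial (Fin d) ℝ}
    (h : ∫ x in s, w x * polyVal p x ^ 2 = 0) : p = 0 := by
  have hcont : Continuous fun x => w x * polyVal p x ^ 2 := by fun_prop
  have h0 := (setIntegral_eq_zero_iff_of_nonneg_ae (μ := volume) (s := s)
    (f := fun x => w x * polyVal p x ^ 2)
    ((ae_restrict_iff' hs.measurableSet).2 (.of_forall fun x hx =>
      mul_nonneg (hw0 x hx) (sq_nonneg _)))
    (hcont.continuousOn.integrableOn_compact hs)).1 h
  have h1 := Measure.eqOn_open_of_ae_eq (μ := volume) (ae_restrict_of_ae_restrict_of_subset hUs h0)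
    hU hcont.continuousOn continuousOn_const
  refine eq_zero_of_polyVal_eq_zero_on hU hne fun x hx => ?_
  have := h1 hx
  simpa [(hwU x hx).ne'] using this

/-- On polynomials of degree at most `k` the supremum over the unit ball is controlled by the
`L²` norm over a ball of radius `c`. -/
lemma exists_sq_polyVal_le_integral_closedBall (d k : ℕ) {c : ℝ} (hc : 0 < c) :
    ∃ C : ℝ, 0 ≤ C ∧ ∀ p : MvPolynomial (Fin d) ℝ, p.totalDegree ≤ k →
      ∀ y : EuclideanSpace ℝ (Fin d), ‖y‖ ≤ 1 →
        polyVal p y ^ 2 ≤ C * ∫ x in Metric.closedBall 0 c, polyVal p x ^ 2 := by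
  classical
  set μ : Measure (EuclideanSpace ℝ (Fin d)) := volume.restrict (Metric.closedBall 0 c)
  have hμ : ∀ g : EuclideanSpace ℝ (Fin d) → ℝ, Continuous g → Integrable g μ := fun g hg =>
    hg.continuousOn.integrableOn_compact (isCompact_closedBall _ _)
  let V := MvPolynomial.restrictTotalDegree (Fin d) ℝ k
  let b := Module.finBasis ℝ V
  -- Each coordinate functional of a fixed basis is an `L²` product with some `u i`, so
  -- Cauchy–Schwarz bounds the coordinates of `p` by its norm on the ball.
  have hrep : ∀ i, ∃ u : MvPolynomial (Fin d) ℝ, ∀ p : V,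
      ∫ x, polyVal u x * polyVal p.1 x ∂μ = b.repr p i := by
    intro i
    obtain ⟨Φ, hΦ⟩ := LinearMap.exists_extend (b.coord i)
    obtain ⟨u, -, hu⟩ := exists_integral_mul_eq hμ (w := fun _ => 1) continuous_const k Φ
      (fun p _ hp => by
        have : p = 0 := eq_zero_of_setIntegral_mul_sq_eq_zero (isCompact_closedBall _ _)
          Metric.isOpen_ball ⟨0, Metric.mem_ball_self hc⟩ Metric.ball_subset_closedBall
          continuous_const (fun _ _ => zero_le_one) (fun _ _ => zero_lt_one) hp
        rw [this, map_zero])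
    refine ⟨u, fun p => ?_⟩
    have := hu p.1 ((MvPolynomial.mem_restrictTotalDegree _ _ _).1 p.2)
    simp only [one_mul] at this
    rw [this, ← Module.Basis.coord_apply, ← hΦ]
    rfl
  choose u hu using hrep
  have hbd : ∀ i, ∃ M : ℝ, ∀ y : EuclideanSpace ℝ (Fin d), ‖y‖ ≤ 1 → polyVal (b i).1 y ^ 2 ≤ M := by
    intro i
    obtain ⟨M, hM⟩ := (isCompact_closedBall (0 : EuclideanSpace ℝ (Fin d)) 1).bddAbove_image
      (f := fun y => polyVal (b i).1 y ^ 2) (by fun_prop)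
    exact ⟨M, fun y hy => hM ⟨y, by simpa using hy, rfl⟩⟩
  choose M hM using hbd
  have hM0 : ∀ i, 0 ≤ M i := fun i => (sq_nonneg _).trans (hM i 0 (by simp))
  refine ⟨(∑ i, ∫ x, polyVal (u i) x ^ 2 ∂μ) * ∑ i, M i, by
    refine mul_nonneg (Finset.sum_nonneg fun i _ => integral_nonneg fun x => sq_nonneg _)
      (Finset.sum_nonneg fun i _ => hM0 i), fun p hp y hy => ?_⟩
  let P : V := ⟨p, (MvPolynomial.mem_restrictTotalDegree _ _ _).2 hp⟩
  have hPy : polyVal p y = ∑ i, b.repr P i * polyVal (b i).1 y := by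
    have : p = ∑ i, b.repr P i • (b i).1 := by
      have := congrArg V.subtype (b.sum_repr P)
      rw [map_sum] at this
      exact this.symm
    conv_lhs => rw [this]
    simp
  have hcoord : ∀ i, b.repr P i ^ 2 ≤ (∫ x, polyVal (u i) x ^ 2 ∂μ) * ∫ x, polyVal p x ^ 2 ∂μ := by
    intro i
    rw [← hu i P]
    exact sq_integral_mul_le (hμ _ (by fun_prop)) (hμ _ (by fun_prop)) (hμ _ (by fun_prop))
  calc polyVal p y ^ 2 ≤ (∑ i, b.repr P i ^ 2) * ∑ i, polyVal (b i).1 y ^ 2 := by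
        rw [hPy]; exact Finset.sum_mul_sq_le_sq_mul_sq _ _ _
    _ ≤ (∑ i, (∫ x, polyVal (u i) x ^ 2 ∂μ) * ∫ x, polyVal p x ^ 2 ∂μ) * ∑ i, M i := by
        refine mul_le_mul (Finset.sum_le_sum fun i _ => hcoord i)
          (Finset.sum_le_sum fun i _ => hM i y hy) (Finset.sum_nonneg fun i _ => sq_nonneg _)
          (Finset.sum_nonneg fun i _ => (sq_nonneg _).trans (hcoord i))
    _ = _ := by rw [← Finset.sum_mul]; ring

end Riesz

/-! ### Facets, their hyperplanes and their neighbors -/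

namespace ConvexPolytope

variable {d n : ℕ} (T : ConvexPolytope d n)

/-- The signed distance from `x` to the hyperplane of the `i`-th facet, nonnegative on `T`. -/
noncomputable def gap (i : Fin n) (x : EuclideanSpace ℝ (Fin d)) : ℝ :=
  T.offset i - inner ℝ (T.normal i) x

lemma gap_add (i : Fin n) (x v : EuclideanSpace ℝ (Fin d)) :
    T.gap i (x + v) = T.gap i x - inner ℝ (T.normal i) v := by
  rw [gap, gap, inner_add_right]; ring

lemma gap_add_smul_sub (i : Fin n) (x y : EuclideanSpace ℝ (Fin d)) (t : ℝ) :
    T.gap i (x + t • (y - x)) = (1 - t) * T.gap i x + t * T.gap i y := by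
  simp only [gap, inner_add_right, inner_smul_right, inner_sub_right]; ring

lemma gap_sub_gap (i : Fin n) (x y : EuclideanSpace ℝ (Fin d)) :
    T.gap i x - T.gap i y = inner ℝ (T.normal i) (y - x) := by
  rw [gap, gap, inner_sub_right]; ring

lemma inner_normal_self (i : Fin n) : inner ℝ (T.normal i) (T.normal i) = 1 := by
  rw [real_inner_self_eq_norm_sq, T.norm_normal]; norm_num

@[fun_prop] lemma continuous_gap (i : Fin n) : Continuous (T.gap i) := by
  unfold gap; fun_prop

lemma mem_carrier_iff {x : EuclideanSpace ℝ (Fin d)} : x ∈ T.carrier ↔ ∀ i, 0 ≤ T.gap i x := by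
  simp [carrier, gap]

lemma mem_facet_iff {j : Fin n} {x : EuclideanSpace ℝ (Fin d)} :
    x ∈ T.facet j ↔ (∀ i, 0 ≤ T.gap i x) ∧ T.gap j x = 0 := by
  rw [facet, Set.mem_ofPred_eq, mem_carrier_iff, gap, sub_eq_zero, eq_comm (a := T.offset j)]

lemma facet_subset (j : Fin n) : T.facet j ⊆ T.carrier := fun _ hx => hx.1

lemma isClosed_carrier : IsClosed T.carrier := by
  have : T.carrier = ⋂ i, {x | 0 ≤ T.gap i x} := by ext x; simp [mem_carrier_iff]
  rw [this]
  exact isClosed_iInter fun i => isClosed_le continuous_const (T.continuous_gap i)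

lemma isCompact_carrier : IsCompact T.carrier :=
  Metric.isCompact_of_isClosed_isBounded T.isClosed_carrier T.isBounded

lemma isCompact_facet (j : Fin n) : IsCompact (T.facet j) := by
  have : T.facet j = T.carrier ∩ {x | T.gap j x = 0} := by
    ext x; rw [mem_facet_iff, Set.mem_inter_iff, mem_carrier_iff, Set.mem_ofPred_eq]
  rw [this]
  exact T.isCompact_carrier.inter_right (isClosed_eq (T.continuous_gap j) continuous_const)

lemma convex_facet (j : Fin n) : Convex ℝ (T.facet j) := by
  intro x hx y hy a b ha hb hab
  rw [mem_facet_iff] at *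
  have h : ∀ i, T.gap i (a • x + b • y) = a * T.gap i x + b * T.gap i y := by
    intro i
    simp only [gap, inner_add_right, inner_smul_right]
    linear_combination (-T.offset i) * hab
  refine ⟨fun i => ?_, by rw [h, hx.2, hy.2]; simp⟩
  rw [h]
  exact add_nonneg (mul_nonneg ha (hx.1 i)) (mul_nonneg hb (hy.1 i))

/-- From an interior point one can still move a little along each outward normal without leaving
`T`. -/
lemma exists_forall_gap_pos : ∃ x, ∀ i, 0 < T.gap i x := by
  obtain ⟨x, hx⟩ := T.interior_nonempty
  refine ⟨x, fun i => ?_⟩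
  obtain ⟨ε, hε, hball⟩ := Metric.isOpen_iff.1 isOpen_interior x hx
  have hmem : x + (ε / 2) • T.normal i ∈ T.carrier := by
    refine interior_subset (hball ?_)
    rw [Metric.mem_ball, dist_self_add_left, norm_smul, T.norm_normal, Real.norm_eq_abs,
      abs_of_pos (half_pos hε)]
    linarith
  have := (T.mem_carrier_iff.1 hmem) i
  rw [gap_add, inner_smul_right, inner_normal_self] at this
  linarith

lemma finrank_direction_facet (j : Fin n) :
    Module.finrank ℝ (affineSpan ℝ (T.facet j)).direction = d - 1 := T.finrank_facet j

lemma facet_nonempty (hd : 2 ≤ d) (j : Fin n) : (T.facet j).Nonempty := by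
  by_contra h
  have h1 := T.finrank_direction_facet j
  rw [Set.not_nonempty_iff_eq_empty.1 h, AffineSubspace.span_empty,
    AffineSubspace.direction_bot, finrank_bot] at h1
  omega

lemma finrank_orthogonal_normal (j : Fin n) :
    Module.finrank ℝ (ℝ ∙ T.normal j)ᗮ = d - 1 := by
  have h := Submodule.finrank_add_finrank_orthogonal (ℝ ∙ T.normal j)
  rw [finrank_span_singleton (by rw [← norm_ne_zero_iff, T.norm_normal]; norm_num),
    finrank_euclideanSpace_fin] at h
  omega

/-- One inclusion is clear; the facet has full dimension `d - 1`, so the two spaces agree. -/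
lemma direction_facet (j : Fin n) :
    (affineSpan ℝ (T.facet j)).direction = (ℝ ∙ T.normal j)ᗮ := by
  refine Submodule.eq_of_le_of_finrank_eq ?_
    ((T.finrank_direction_facet j).trans (T.finrank_orthogonal_normal j).symm)
  rw [direction_affineSpan, vectorSpan_def, Submodule.span_le]
  rintro _ ⟨x, hx, y, hy, rfl⟩
  rw [SetLike.mem_coe, Submodule.mem_orthogonal_singleton_iff_inner_right]
  have := T.gap_sub_gap j y x
  rw [(T.mem_facet_iff.1 hx).2, (T.mem_facet_iff.1 hy).2] at this
  simpa using this.symm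

/-- An affine function vanishing on a facet is a multiple of the distance to its hyperplane. -/
lemma exists_eq_mul_gap (hd : 2 ≤ d) {j : Fin n} {c : ℝ} {w : EuclideanSpace ℝ (Fin d)}
    (h : ∀ x ∈ T.facet j, c + inner ℝ w x = 0) :
    ∃ κ : ℝ, w = -κ • T.normal j ∧ ∀ x, c + inner ℝ w x = κ * T.gap j x := by
  -- `w` is orthogonal to the direction of the facet, which is the complement of the normal line;
  -- hence `w` lies on that line.
  have hw : w ∈ (ℝ ∙ T.normal j)ᗮᗮ := by
    rw [← direction_facet, direction_affineSpan, vectorSpan_def, Submodule.mem_orthogonal']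
    intro u hu
    refine Submodule.span_induction (p := fun u _ => inner ℝ w u = 0) ?_ (by simp)
      (fun u v _ _ hu hv => by rw [inner_add_right, hu, hv, add_zero])
      (fun a u _ hu => by rw [inner_smul_right, hu, mul_zero]) hu
    rintro _ ⟨x, hx, y, hy, rfl⟩
    have := h x hx
    have := h y hy
    simp only [vsub_eq_sub, inner_sub_right]
    linarith
  rw [Submodule.orthogonal_orthogonal] at hw
  obtain ⟨κ, rfl⟩ := Submodule.mem_span_singleton.1 hw
  refine ⟨-κ, by simp, fun x => ?_⟩
  obtain ⟨y, hy⟩ := T.facet_nonempty hd j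
  have h1 := h y hy
  have h2 := (T.mem_facet_iff.1 hy).2
  rw [gap] at h2
  rw [real_inner_smul_left] at h1 ⊢
  rw [gap]
  linear_combination h1 + κ * h2

/-- The two distance functions are then proportional. The factor is positive by comparison at an
interior point and equals 1 because the normals are unit vectors, so the facets coincide. -/
lemma eq_of_gap_eq_zero_on_facet (hd : 2 ≤ d) {i j : Fin n}
    (h : ∀ x ∈ T.facet i, T.gap j x = 0) : i = j := by
  obtain ⟨κ, hw, hκ⟩ := T.exists_eq_mul_gap hd (j := i) (c := T.offset j) (w := -T.normal j)
    (fun x hx => by rw [← h x hx, gap, inner_neg_left]; ring)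
  have hg : ∀ x, T.gap j x = κ * T.gap i x := fun x => by
    rw [← hκ, gap, inner_neg_left]; ring
  obtain ⟨x, hx⟩ := T.exists_forall_gap_pos
  have hκ0 : 0 < κ := by
    have := hx j
    rw [hg] at this
    exact pos_of_mul_pos_left this (hx i).le
  have hκ1 : κ = 1 := by
    have := congrArg norm hw
    rwa [norm_neg, norm_smul, T.norm_normal, T.norm_normal, norm_neg, Real.norm_eq_abs,
      abs_of_pos hκ0, mul_one, eq_comm] at this
  refine T.facet_injective ?_
  change T.facet i = T.facet j
  ext x
  rw [mem_facet_iff, mem_facet_iff, hg x, hκ1, one_mul]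

/-- For each other constraint some point of `e_j` is strict, since distinct facets do not share a
hyperplane. Midpoints make finitely many constraints strict at once. -/
lemma exists_mem_facet_forall_gap_pos (hd : 2 ≤ d) (j : Fin n) :
    ∃ y ∈ T.facet j, ∀ i, i ≠ j → 0 < T.gap i y := by
  classical
  suffices h : ∀ S : Finset (Fin n), ∃ y ∈ T.facet j, ∀ i ∈ S, i ≠ j → 0 < T.gap i y by
    obtain ⟨y, hy, h⟩ := h Finset.univ
    exact ⟨y, hy, fun i => h i (Finset.mem_univ i)⟩
  intro S
  induction S using Finset.induction_on with
  | empty =>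
    obtain ⟨y, hy⟩ := T.facet_nonempty hd j
    exact ⟨y, hy, by simp⟩
  | insert i S _ ih =>
    obtain ⟨y, hy, hyS⟩ := ih
    by_cases hij : i = j
    · refine ⟨y, hy, fun k hk hkj => ?_⟩
      rcases Finset.mem_insert.1 hk with rfl | hk
      · exact absurd hij hkj
      · exact hyS k hk hkj
    obtain ⟨z, hz, hzi⟩ : ∃ z ∈ T.facet j, T.gap i z ≠ 0 := by
      by_contra! h
      exact hij (T.eq_of_gap_eq_zero_on_facet hd h).symm
    have hy' := T.mem_facet_iff.1 hy
    have hz' := T.mem_facet_iff.1 hz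
    refine ⟨y + (1 / 2 : ℝ) • (z - y), T.mem_facet_iff.2 ⟨fun k => ?_, ?_⟩, fun k hk hkj => ?_⟩
    · rw [gap_add_smul_sub]
      linarith [hy'.1 k, hz'.1 k]
    · rw [gap_add_smul_sub, hy'.2, hz'.2]; simp
    · rw [gap_add_smul_sub]
      rcases Finset.mem_insert.1 hk with rfl | hk
      · have := (hz'.1 k).lt_of_ne' hzi
        linarith [hy'.1 k]
      · linarith [hyS k hk hkj, hz'.1 k]

/-- If near a point `x` of the `j`-th hyperplane all points on the trace of the `i`-th hyperplane
belong to `e_j`, then `e_i` is a neighbor of `e_j`. -/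
lemma isNeighbor_of_ball {i j : Fin n} (hij : i ≠ j)
    {y z : EuclideanSpace ℝ (Fin d)} (hy : T.gap j y = 0) (hz : T.gap j z = 0)
    (hyz : T.gap i y ≠ T.gap i z) {x : EuclideanSpace ℝ (Fin d)} {ε : ℝ} (hε : 0 < ε)
    (h : ∀ v, ‖v‖ < ε → T.gap j (x + v) = 0 → T.gap i (x + v) = 0 → x + v ∈ T.facet j)
    (hxj : T.gap j x = 0) (hxi : T.gap i x = 0) : T.IsNeighbor j i := by
  have hmem : ∀ v, ‖v‖ < ε → inner ℝ (T.normal j) v = 0 → inner ℝ (T.normal i) v = 0 →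
      x + v ∈ T.facet j ∩ T.facet i := by
    intro v hv hvj hvi
    have h1 := h v hv (by rw [gap_add, hxj, hvj, sub_zero]) (by rw [gap_add, hxi, hvi, sub_zero])
    exact ⟨h1, T.mem_facet_iff.2 ⟨(T.mem_facet_iff.1 h1).1, by rw [gap_add, hxi, hvi, sub_zero]⟩⟩
  have hx : x ∈ T.facet j ∩ T.facet i := by
    simpa using hmem 0 (by simpa using hε) (by simp) (by simp)
  refine ⟨hij, ⟨x, hx⟩, ?_⟩
  set W := Submodule.span ℝ (Set.range ![T.normal j, T.normal i])
  have hW : ∀ v, v ∈ Wᗮ ↔ inner ℝ (T.normal j) v = 0 ∧ inner ℝ (T.normal i) v = 0 := by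
    intro v
    rw [Submodule.mem_orthogonal]
    constructor
    · intro hv
      exact ⟨hv _ (Submodule.subset_span ⟨0, rfl⟩), hv _ (Submodule.subset_span ⟨1, rfl⟩)⟩
    · rintro ⟨h1, h2⟩ u hu
      refine Submodule.span_induction (p := fun u _ => inner ℝ u v = 0) ?_ (by simp)
        (fun u u' _ _ hu hv => by rw [inner_add_left, hu, hv, add_zero])
        (fun a u _ hu => by rw [real_inner_smul_left, hu, mul_zero]) hu
      rintro _ ⟨k, rfl⟩
      fin_cases k
      · exact h1
      · exact h2
  -- Near `x` the intersection of the two facets fills the common trace of their hyperplanes, so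
  -- every direction in that trace is attained after scaling it down.
  have hdir : (affineSpan ℝ (T.facet j ∩ T.facet i)).direction = Wᗮ := by
    rw [direction_affineSpan]
    apply le_antisymm
    · rw [vectorSpan_def, Submodule.span_le]
      rintro _ ⟨p, hp, q, hq, rfl⟩
      rw [SetLike.mem_coe, hW]
      simp [← gap_sub_gap, (T.mem_facet_iff.1 hp.1).2, (T.mem_facet_iff.1 hp.2).2, (T.mem_facet_iff.1 hq.1).2,
        (T.mem_facet_iff.1 hq.2).2]
    · intro v hv
      obtain ⟨hvj, hvi⟩ := (hW v).1 hv
      set t : ℝ := ε / (2 * (‖v‖ + 1))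
      have ht : 0 < t := by positivity
      have htv : ‖t • v‖ < ε := by
        rw [norm_smul, Real.norm_eq_abs, abs_of_pos ht, div_mul_eq_mul_div,
          div_lt_iff₀ (by positivity)]
        nlinarith [norm_nonneg v]
      have h1 := hmem (t • v) htv (by rw [inner_smul_right, hvj, mul_zero])
        (by rw [inner_smul_right, hvi, mul_zero])
      have h2 := vsub_mem_vectorSpan ℝ h1 hx
      rw [vsub_eq_sub, add_sub_cancel_left] at h2
      have h3 := Submodule.smul_mem _ t⁻¹ h2
      rwa [smul_smul, inv_mul_cancel₀ ht.ne', one_smul] at h3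
  -- If the normals were dependent, `gap i` would be constant on the `j`-th hyperplane, against
  -- `hyz`.
  have hlin : LinearIndependent ℝ ![T.normal j, T.normal i] := by
    rw [LinearIndependent.pair_iff]
    intro a b hab
    have h1 : a * inner ℝ (T.normal j) (z - y) + b * inner ℝ (T.normal i) (z - y) = 0 := by
      rw [← real_inner_smul_left, ← real_inner_smul_left, ← inner_add_left, hab, inner_zero_left]
    rw [← gap_sub_gap, ← gap_sub_gap, hy, hz, sub_self, mul_zero, zero_add] at h1
    have hb : b = 0 := (mul_eq_zero.1 h1).resolve_right (sub_ne_zero.2 hyz)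
    subst hb
    rw [zero_smul, add_zero] at hab
    refine ⟨(smul_eq_zero.1 hab).resolve_right ?_, rfl⟩
    exact norm_ne_zero_iff.1 (by rw [T.norm_normal]; norm_num)
  have hrank := Submodule.finrank_add_finrank_orthogonal W
  rw [finrank_span_eq_card hlin, finrank_euclideanSpace_fin, Fintype.card_fin] at hrank
  rw [hdir]
  omega

/-- A facet is cut out of its hyperplane by its neighbors. -/
lemma exists_neighbors (hd : 2 ≤ d) (j : Fin n) :
    ∃ S : Finset (Fin n), (∀ i ∈ S, T.IsNeighbor j i) ∧
      ∀ x, T.gap j x = 0 → (∀ i ∈ S, 0 ≤ T.gap i x) → x ∈ T.facet j := by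
  classical
  -- A smallest family of constraints that cuts `e_j` out of its hyperplane contains no redundant
  -- one; each of its members will turn out to be a neighbor.
  let P : Finset (Fin n) → Prop := fun S => j ∉ S ∧
    ∀ x, T.gap j x = 0 → (∀ i ∈ S, 0 ≤ T.gap i x) → x ∈ T.facet j
  obtain ⟨S, hS, hmin⟩ := (Finset.univ.filter P).exists_min_image Finset.card
    ⟨Finset.univ.erase j, by
      refine Finset.mem_filter.2 ⟨Finset.mem_univ _, by simp, fun x hx h => T.mem_facet_iff.2 ⟨?_, hx⟩⟩
      intro i
      by_cases hij : i = j
      · rw [hij, hx]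
      · exact h i (by simp [hij])⟩
  obtain ⟨-, hjS, hS⟩ := Finset.mem_filter.1 hS
  refine ⟨S, fun i hi => ?_, hS⟩
  have hij : i ≠ j := fun h => hjS (h ▸ hi)
  obtain ⟨y, hyj, hyS, hyi⟩ : ∃ y, T.gap j y = 0 ∧ (∀ k ∈ S.erase i, 0 ≤ T.gap k y) ∧
      T.gap i y < 0 := by
    by_contra! h
    have hP : P (S.erase i) := by
      refine ⟨fun h => hjS (Finset.mem_of_mem_erase h), fun x hx hxS => hS x hx fun k hk => ?_⟩
      by_cases hki : k = i
      · exact hki ▸ h x hx hxS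
      · exact hxS k (Finset.mem_erase.2 ⟨hki, hk⟩)
    have := hmin _ (Finset.mem_filter.2 ⟨Finset.mem_univ _, hP⟩)
    exact absurd this (not_le.2 (Finset.card_erase_lt_of_mem hi))
  obtain ⟨m, hm, hmpos⟩ := T.exists_mem_facet_forall_gap_pos hd j
  have hmj := (T.mem_facet_iff.1 hm).2
  have hmi := hmpos i hij
  -- The segment from the relative interior point `m` to `y` meets the `i`-th hyperplane at this
  -- parameter; there all other constraints of `S` are strict.
  set t := T.gap i m / (T.gap i m - T.gap i y)
  have hden : 0 < T.gap i m - T.gap i y := by linarith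
  have ht0 : 0 < t := div_pos hmi hden
  have ht1 : t < 1 := by rw [div_lt_one hden]; linarith
  set x := m + t • (y - m)
  have hxj : T.gap j x = 0 := by rw [gap_add_smul_sub, hmj, hyj]; simp
  have hxi : T.gap i x = 0 := by
    rw [gap_add_smul_sub]
    simp only [t]
    field_simp
    ring
  have hxpos : ∀ k ∈ S.erase i, 0 < T.gap k x := by
    intro k hk
    have hkj : k ≠ j := fun h => hjS (h ▸ Finset.mem_of_mem_erase hk)
    rw [gap_add_smul_sub]
    have := mul_pos (sub_pos.2 ht1) (hmpos k hkj)
    have := mul_nonneg ht0.le (hyS k hk)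
    linarith
  have hopen : IsOpen (⋂ k ∈ S.erase i, {z | 0 < T.gap k z}) :=
    isOpen_biInter_finset fun k _ => isOpen_lt continuous_const (T.continuous_gap k)
  obtain ⟨ε, hε, hball⟩ := Metric.isOpen_iff.1 hopen x (by simpa using hxpos)
  refine T.isNeighbor_of_ball hij hyj hmj (hyi.trans hmi).ne hε (fun v hv hvj hvi => ?_) hxj hxi
  refine hS _ hvj fun k hk => ?_
  by_cases hki : k = i
  · rw [hki, hvi]
  · have : x + v ∈ ⋂ k ∈ S.erase i, {z | 0 < T.gap k z} :=
      hball (by simpa [Metric.mem_ball] using hv)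
    exact le_of_lt (Set.mem_iInter₂.1 this k (Finset.mem_erase.2 ⟨hki, hk⟩))

end ConvexPolytope

/-! ### Charts of a facet, its surface measure, and bounds on the distances to the facets -/

namespace ConvexPolytope

variable {d n : ℕ} (T : ConvexPolytope d n)

/-- Linear isometries parametrizing the direction of the `j`-th facet hyperplane. -/
def IsChart (j : Fin n) (L : EuclideanSpace ℝ (Fin (d - 1)) →ₗᵢ[ℝ] EuclideanSpace ℝ (Fin d)) :
    Prop :=
  ∀ v, inner ℝ (T.normal j) v = 0 ↔ ∃ y, L y = v

lemma exists_isChart (j : Fin n) : ∃ L, T.IsChart j L := by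
  let b := (stdOrthonormalBasis ℝ (ℝ ∙ T.normal j)ᗮ).reindex
    (finCongr (T.finrank_orthogonal_normal j))
  refine ⟨(Submodule.subtypeₗᵢ _).comp b.repr.symm.toLinearIsometry, fun v => ?_⟩
  rw [← Submodule.mem_orthogonal_singleton_iff_inner_right]
  constructor
  · intro hv
    exact ⟨b.repr ⟨v, hv⟩, by simp⟩
  · rintro ⟨y, rfl⟩
    exact (b.repr.symm y).2

variable {T}

lemma IsChart.inner_eq_zero {j : Fin n} {L} (hL : T.IsChart j L) (y) :
    inner ℝ (T.normal j) (L y) = 0 := (hL _).2 ⟨y, rfl⟩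

lemma IsChart.gap_eq_zero {j : Fin n} {L} (hL : T.IsChart j L) {m : EuclideanSpace ℝ (Fin d)}
    (hm : T.gap j m = 0) (y) : T.gap j (m + L y) = 0 := by
  rw [gap_add, hm, hL.inner_eq_zero, sub_zero]

lemma IsChart.exists_eq {j : Fin n} {L} (hL : T.IsChart j L) {m : EuclideanSpace ℝ (Fin d)}
    (hm : T.gap j m = 0) {x} (hx : T.gap j x = 0) : ∃ y, m + L y = x := by
  obtain ⟨y, hy⟩ := (hL (x - m)).1 (by rw [← gap_sub_gap, hm, hx, sub_zero])
  exact ⟨y, by rw [hy, add_sub_cancel]⟩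

lemma isometry_const_add {e : ℕ} (m : EuclideanSpace ℝ (Fin d))
    (L : EuclideanSpace ℝ (Fin e) →ₗᵢ[ℝ] EuclideanSpace ℝ (Fin d)) :
    Isometry fun y => m + L y :=
  (IsometryEquiv.addLeft m).isometry.comp L.isometry

/-- Isometries preserve Hausdorff measure, which in the full dimension of the chart is Lebesgue
measure; surface integrals thus become integrals over a subset of `ℝ^(d-1)`. -/
lemma IsChart.surface_eq_map {j : Fin n} {L} (hL : T.IsChart j L) {m : EuclideanSpace ℝ (Fin d)}
    (hm : T.gap j m = 0) :
    T.surface j = (volume.restrict ((fun y => m + L y) ⁻¹' T.facet j)).map fun y => m + L y := by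
  have hiso := isometry_const_add m L
  have hsub : T.facet j ⊆ Set.range fun y => m + L y := fun x hx =>
    hL.exists_eq hm (T.mem_facet_iff.1 hx).2
  have hmeas : MeasurableSet (T.facet j) := (T.isCompact_facet j).measurableSet
  rw [← Measure.restrict_map hiso.continuous.measurable hmeas,
    ← EuclideanSpace.euclideanHausdorffMeasure_eq_volume, hiso.map_euclideanHausdorffMeasure,
    Measure.restrict_restrict hmeas, Set.inter_eq_left.2 hsub, surface]

lemma IsChart.integral_surface {j : Fin n} {L} (hL : T.IsChart j L) {m : EuclideanSpace ℝ (Fin d)}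
    (hm : T.gap j m = 0) (g : EuclideanSpace ℝ (Fin d) → ℝ) :
    ∫ x, g x ∂(T.surface j) = ∫ y in (fun y => m + L y) ⁻¹' T.facet j, g (m + L y) := by
  rw [hL.surface_eq_map hm,
    (isometry_const_add m L).isClosedEmbedding.measurableEmbedding.integral_map]

lemma isCompact_preimage_facet (j : Fin n) (m : EuclideanSpace ℝ (Fin d)) {e : ℕ}
    (L : EuclideanSpace ℝ (Fin e) →ₗᵢ[ℝ] EuclideanSpace ℝ (Fin d)) :
    IsCompact ((fun y => m + L y) ⁻¹' T.facet j) :=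
  (isometry_const_add m L).isClosedEmbedding.isCompact_preimage (T.isCompact_facet j)

/-- The relative interior of a facet in a chart. -/
lemma IsChart.relInterior {j : Fin n} {L} (hL : T.IsChart j L) (hd : 2 ≤ d)
    {m : EuclideanSpace ℝ (Fin d)} (hm : T.gap j m = 0) :
    IsOpen {y | ∀ i, i ≠ j → 0 < T.gap i (m + L y)} ∧
    {y | ∀ i, i ≠ j → 0 < T.gap i (m + L y)}.Nonempty ∧
    {y | ∀ i, i ≠ j → 0 < T.gap i (m + L y)} ⊆ (fun y => m + L y) ⁻¹' T.facet j := by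
  refine ⟨?_, ?_, fun y hy => T.mem_facet_iff.2 ⟨fun i => ?_, hL.gap_eq_zero hm y⟩⟩
  · have : {y | ∀ i, i ≠ j → 0 < T.gap i (m + L y)}
        = ⋂ i, ⋂ (_ : i ≠ j), {y | 0 < T.gap i (m + L y)} := by ext; simp
    rw [this]
    refine isOpen_iInter_of_finite fun i => isOpen_iInter_of_finite fun _ =>
      isOpen_lt continuous_const ((T.continuous_gap i).comp (isometry_const_add m L).continuous)
  · obtain ⟨x, hx, hpos⟩ := T.exists_mem_facet_forall_gap_pos hd j
    obtain ⟨y, rfl⟩ := hL.exists_eq hm (T.mem_facet_iff.1 hx).2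
    exact ⟨y, hpos⟩
  · by_cases hij : i = j
    · rw [hij, hL.gap_eq_zero hm]
    · exact (hy i hij).le

variable (T)

lemma isFiniteMeasure_surface (hd : 2 ≤ d) (j : Fin n) : IsFiniteMeasure (T.surface j) := by
  obtain ⟨L, hL⟩ := T.exists_isChart j
  obtain ⟨m, hm⟩ := T.facet_nonempty hd j
  rw [hL.surface_eq_map (T.mem_facet_iff.1 hm).2]
  have : IsFiniteMeasure (volume.restrict ((fun y => m + L y) ⁻¹' T.facet j)) :=
    isFiniteMeasure_restrict.2 (isCompact_preimage_facet j m L).measure_ne_top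
  infer_instance

lemma neZero_surface (hd : 2 ≤ d) (j : Fin n) : NeZero (T.surface j) := by
  obtain ⟨L, hL⟩ := T.exists_isChart j
  obtain ⟨m, hm⟩ := T.facet_nonempty hd j
  have hm := (T.mem_facet_iff.1 hm).2
  obtain ⟨ho, hne, hsub⟩ := hL.relInterior hd hm
  refine ⟨fun h => ?_⟩
  rw [hL.surface_eq_map hm, Measure.map_eq_zero_iff
    (isometry_const_add m L).continuous.measurable.aemeasurable, Measure.restrict_eq_zero] at h
  exact (ho.measure_pos volume hne).ne' (measure_mono_null hsub h)

lemma ae_mem_facet (j : Fin n) : ∀ᵐ x ∂(T.surface j), x ∈ T.facet j :=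
  ae_restrict_mem (T.isCompact_facet j).measurableSet

lemma integrable_surface {F : Type*} [NormedAddCommGroup F] (hd : 2 ≤ d) (j : Fin n)
    {g : EuclideanSpace ℝ (Fin d) → F} (hg : Continuous g) [SecondCountableTopology F] :
    Integrable g (T.surface j) := by
  have := T.isFiniteMeasure_surface hd j
  obtain ⟨C, hC⟩ := (T.isCompact_facet j).exists_bound_of_continuousOn hg.continuousOn
  exact Integrable.of_bound hg.aestronglyMeasurable C
    ((T.ae_mem_facet j).mono fun x hx => hC x hx)

lemma integrable_carrier {g : EuclideanSpace ℝ (Fin d) → ℝ} (hg : Continuous g) :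
    Integrable g (volume.restrict T.carrier) :=
  hg.continuousOn.integrableOn_compact T.isCompact_carrier

lemma barycenter_mem_facet (hd : 2 ≤ d) (j : Fin n) : T.barycenter j ∈ T.facet j := by
  have := T.isFiniteMeasure_surface hd j
  have := T.neZero_surface hd j
  exact (T.convex_facet j).average_mem (T.isCompact_facet j).isClosed (T.ae_mem_facet j)
    (T.integrable_surface hd j continuous_id)

/-- A polynomial whose weighted `L²` norm on a facet vanishes is zero on the hyperplane. -/
lemma polyVal_eq_zero_of_integral_surface (hd : 2 ≤ d) {j : Fin n}
    {w : EuclideanSpace ℝ (Fin d) → ℝ} (hw : Continuous w) (hw0 : ∀ x ∈ T.facet j, 0 ≤ w x)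
    (hwpos : ∀ x ∈ T.facet j, (∀ i, i ≠ j → 0 < T.gap i x) → 0 < w x)
    {p : MvPolynomial (Fin d) ℝ} (h : ∫ x, w x * polyVal p x ^ 2 ∂(T.surface j) = 0)
    {x : EuclideanSpace ℝ (Fin d)} (hx : T.gap j x = 0) : polyVal p x = 0 := by
  obtain ⟨L, hL⟩ := T.exists_isChart j
  obtain ⟨ho, hne, hsub⟩ := hL.relInterior hd hx
  obtain ⟨q, -, hq⟩ := exists_polyVal_comp_affine x L.toLinearMap p
  have hq' : ∀ y, polyVal p (x + L y) = polyVal q y := fun y => (hq y).symm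
  rw [hL.integral_surface hx] at h
  simp only [hq'] at h
  have hq0 : q = 0 := eq_zero_of_setIntegral_mul_sq_eq_zero (isCompact_preimage_facet j x L) ho hne
    hsub (hw.comp (isometry_const_add x L).continuous) (fun y hy => hw0 _ hy)
    (fun y hy => hwpos _ (hsub hy) hy) h
  have := hq' 0
  rwa [map_zero, add_zero, hq0, polyVal_zero] at this

/-- A disk in the hyperplane of `e_j` not reaching the edges shared with neighbors lies in `e_j`. -/
lemma mem_facet_of_dist_lt (hd : 2 ≤ d) {j : Fin n} {m : EuclideanSpace ℝ (Fin d)}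
    (hm : m ∈ T.facet j) {r : ℝ}
    (hr : ∀ i, T.IsNeighbor j i → r ≤ Metric.infDist m (T.facet j ∩ T.facet i))
    {y : EuclideanSpace ℝ (Fin d)} (hy : T.gap j y = 0) (hyr : dist y m < r) : y ∈ T.facet j := by
  classical
  obtain ⟨S, hS, hSf⟩ := T.exists_neighbors hd j
  by_contra hyf
  have hm' := T.mem_facet_iff.1 hm
  have hmpos : ∀ i ∈ S, 0 < T.gap i m := by
    intro i hi
    refine (hm'.1 i).lt_of_ne' fun h => ?_
    have h1 := hr i (hS i hi)
    rw [Metric.infDist_zero_of_mem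
      (show m ∈ T.facet j ∩ T.facet i from ⟨hm, T.mem_facet_iff.2 ⟨hm'.1, h⟩⟩)] at h1
    exact absurd (dist_nonneg.trans_lt hyr) (not_lt.2 h1)
  -- Among the violated constraints choose the one hit first on the way from `m` to `y`. The exit
  -- point lies in `e_j ∩ e_i` with `e_i` a neighbor, yet closer to `m` than `r`.
  obtain ⟨i, hi, hmin⟩ := (S.filter fun i => T.gap i y < 0).exists_min_image
    (fun i => T.gap i m / (T.gap i m - T.gap i y)) (by
      by_contra h
      rw [Finset.not_nonempty_iff_eq_empty, Finset.filter_eq_empty_iff] at h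
      exact hyf (hSf y hy fun i hi => not_lt.1 (h hi)))
  obtain ⟨hiS, hiy⟩ := Finset.mem_filter.1 hi
  set t := T.gap i m / (T.gap i m - T.gap i y)
  have hden : 0 < T.gap i m - T.gap i y := by linarith [hmpos i hiS]
  have ht0 : 0 < t := div_pos (hmpos i hiS) hden
  have ht1 : t < 1 := by rw [div_lt_one hden]; linarith
  have hxi : T.gap i (m + t • (y - m)) = 0 := by
    rw [gap_add_smul_sub]
    simp only [t]
    field_simp
    ring
  have hx : m + t • (y - m) ∈ T.facet j := by
    refine hSf _ (by rw [gap_add_smul_sub, hy, hm'.2]; simp) fun k hk => ?_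
    rw [gap_add_smul_sub]
    by_cases hky : T.gap k y < 0
    · have h1 := hmin k (Finset.mem_filter.2 ⟨hk, hky⟩)
      rw [le_div_iff₀ (by linarith [hmpos k hk])] at h1
      linarith
    · have := mul_nonneg ht0.le (not_lt.1 hky)
      have := mul_nonneg (sub_nonneg.2 ht1.le) (hmpos k hk).le
      linarith
  have h1 := (hr i (hS i hiS)).trans (Metric.infDist_le_dist_of_mem
    (⟨hx, T.mem_facet_iff.2 ⟨(T.mem_facet_iff.1 hx).1, hxi⟩⟩ :
      m + t • (y - m) ∈ T.facet j ∩ T.facet i))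
  rw [dist_self_add_right, norm_smul, Real.norm_eq_abs, abs_of_pos ht0, ← dist_eq_norm] at h1
  have : t * dist y m ≤ dist y m := mul_le_of_le_one_left dist_nonneg ht1.le
  linarith

/-- On `T` the distance to each facet hyperplane is at most a multiple of its value at `m`. -/
lemma gap_le_mul_gap (hd : 2 ≤ d) {j : Fin n} {m : EuclideanSpace ℝ (Fin d)}
    (hm : T.gap j m = 0) {r K D : ℝ} (hr : 0 < r) (hK : 0 ≤ K)
    (hball : ∀ y, T.gap j y = 0 → dist y m ≤ r → y ∈ T.facet j)
    (hangle : ∀ i, T.IsNeighbor j i → |inner ℝ (T.normal j) (T.normal i)| ≤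
      K * ‖T.normal i - inner ℝ (T.normal j) (T.normal i) • T.normal j‖)
    (hD : ∀ x ∈ T.carrier, dist x m ≤ D) {i : Fin n} (hij : i ≠ j)
    {x : EuclideanSpace ℝ (Fin d)} (hx : x ∈ T.carrier) :
    T.gap i x ≤ (1 + D / r + D * K / r) * T.gap i m := by
  -- Split each normal as `ν_i = b_i ν_j + a_i` with `a_i` tangent to `e_j`.
  set b : Fin n → ℝ := fun i => inner ℝ (T.normal j) (T.normal i) with hb
  set a : Fin n → EuclideanSpace ℝ (Fin d) := fun i => T.normal i - b i • T.normal j with ha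
  have haj : ∀ i, inner ℝ (T.normal j) (a i) = 0 := fun i => by
    simp only [ha, inner_sub_right, inner_smul_right, inner_normal_self, hb]; ring
  have haa : ∀ i, inner ℝ (T.normal i) (a i) = ‖a i‖ ^ 2 := fun i => by
    have : inner ℝ (a i) (a i) = inner ℝ (T.normal i) (a i) - b i * inner ℝ (T.normal j) (a i) := by
      conv_lhs => rw [ha]
      simp only [inner_sub_left, real_inner_smul_left]
      rfl
    rw [← real_inner_self_eq_norm_sq, this, haj]; ring
  -- Test the disk at its point farthest in the direction `a i`.
  have hA : ∀ i, ‖a i‖ * r ≤ T.gap i m := by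
    intro i
    rcases eq_or_ne (a i) 0 with h0 | h0
    · rw [h0, norm_zero, zero_mul]
      exact (T.mem_facet_iff.1 (hball m hm (by simpa using hr.le))).1 i
    · have hn : 0 < ‖a i‖ := norm_pos_iff.2 h0
      have hmem := hball (m + (r / ‖a i‖) • a i)
        (by rw [gap_add, inner_smul_right, haj, hm]; ring)
        (by rw [dist_self_add_left, norm_smul, Real.norm_eq_abs, abs_of_pos (by positivity)]
            field_simp; rfl)
      have := (T.mem_facet_iff.1 hmem).1 i
      rw [gap_add, inner_smul_right, haa] at this
      have h2 : r / ‖a i‖ * ‖a i‖ ^ 2 = ‖a i‖ * r := by field_simp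
      linarith
  have hm0 : ∀ i, 0 ≤ T.gap i m := (T.mem_facet_iff.1 (hball m hm (by simpa using hr.le))).1
  obtain ⟨S, hS, hSf⟩ := T.exists_neighbors hd j
  have hshift : ∀ k (x : EuclideanSpace ℝ (Fin d)) (z : ℝ),
      T.gap k (x + z • T.normal j) = T.gap k x - z * b k := fun k x z => by
    rw [gap_add, inner_smul_right, real_inner_comm]
  -- The angle condition covers only neighbors, so other facets need a convexity argument. A point
  -- of `e_i` at height `z` projects onto the `j`-th hyperplane; contracting the projection toward
  -- `m` by `(1 + τ)⁻¹` puts it in `e_j`, because only neighbors cut out `e_j`. Nonnegativity of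
  -- `gap i` there contradicts `hlt` unless `z = 0`. All of `e_i` would then lie in the `j`-th
  -- hyperplane.
  have hB : ∀ i, i ≠ j → b i * r ≤ K * T.gap i m := by
    intro i hij
    by_contra! hlt
    refine hij (T.eq_of_gap_eq_zero_on_facet hd fun x hx => ?_)
    have hx' := T.mem_facet_iff.1 hx
    set z := T.gap j x
    have hz : 0 ≤ z := hx'.1 j
    set τ := z * K / r
    have hτ : 0 ≤ τ := by positivity
    have hτr : τ * r = z * K := by simp only [τ]; field_simp
    have hy : m + (1 + τ)⁻¹ • (x + z • T.normal j - m) ∈ T.facet j := by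
      refine hSf _ ?_ fun k hk => ?_
      · rw [gap_add_smul_sub, hm, hshift]
        simp [z, hb, T.norm_normal]
      · have h1 := hangle k (hS k hk)
        have h3 : -(τ * T.gap k m) ≤ T.gap k (x + z • T.normal j) := by
          rw [hshift]
          have h4 : z * b k ≤ z * (K * ‖a k‖) :=
            mul_le_mul_of_nonneg_left ((le_abs_self _).trans h1) hz
          have h5 : z * (K * ‖a k‖) = τ * (‖a k‖ * r) := by
            linear_combination (-‖a k‖) * hτr
          have h6 := mul_le_mul_of_nonneg_left (hA k) hτ
          linarith [hx'.1 k]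
        rw [gap_add_smul_sub]
        have h7 : (1 - (1 + τ)⁻¹) * T.gap k m + (1 + τ)⁻¹ * T.gap k (x + z • T.normal j)
            = (1 + τ)⁻¹ * (τ * T.gap k m + T.gap k (x + z • T.normal j)) := by
          field_simp; ring
        rw [h7]
        exact mul_nonneg (by positivity) (by linarith)
    have h1 := (T.mem_facet_iff.1 hy).1 i
    have h7 : (1 - (1 + τ)⁻¹) * T.gap i m + (1 + τ)⁻¹ * T.gap i (x + z • T.normal j)
        = (1 + τ)⁻¹ * (τ * T.gap i m + T.gap i (x + z • T.normal j)) := by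
      field_simp; ring
    rw [gap_add_smul_sub, h7, hshift, hx'.2] at h1
    have h2 := nonneg_of_mul_nonneg_right h1 (by positivity)
    have h3 : 0 ≤ z * (K * T.gap i m - b i * r) := by
      have := mul_nonneg h2 hr.le
      have e : (τ * T.gap i m + (0 - z * b i)) * r = z * (K * T.gap i m - b i * r) := by
        linear_combination T.gap i m * hτr
      linarith
    by_contra hz0
    have hzpos : 0 < z := hz.lt_of_ne' hz0
    have := mul_neg_of_pos_of_neg hzpos (sub_neg.2 hlt)
    linarith
  have hxD := hD x hx
  have hD0 : 0 ≤ D := dist_nonneg.trans hxD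
  have hz : T.gap j x = -inner ℝ (T.normal j) (x - m) := by
    have := T.gap_sub_gap j m x
    rw [hm] at this
    linarith
  have hz0 : 0 ≤ T.gap j x := T.mem_carrier_iff.1 hx j
  have hzD : T.gap j x ≤ D := by
    rw [hz, ← inner_neg_right]
    refine (real_inner_le_norm _ _).trans ?_
    rw [T.norm_normal, one_mul, norm_neg, ← dist_eq_norm]
    exact hxD
  have heq : T.gap i x = T.gap i m - inner ℝ (a i) (x - m) + b i * T.gap j x := by
    have := T.gap_sub_gap i m x
    rw [hz]
    simp only [ha, inner_sub_left, real_inner_smul_left]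
    linarith
  have h1 : -inner ℝ (a i) (x - m) ≤ D / r * T.gap i m := by
    rw [← inner_neg_right]
    refine (real_inner_le_norm _ _).trans ?_
    rw [norm_neg, ← dist_eq_norm]
    calc ‖a i‖ * dist x m ≤ ‖a i‖ * D := mul_le_mul_of_nonneg_left hxD (norm_nonneg _)
      _ = D / r * (‖a i‖ * r) := by field_simp
      _ ≤ D / r * T.gap i m := mul_le_mul_of_nonneg_left (hA i) (by positivity)
  -- A facet leaning inward (`b i ≤ 0` is not the outward case) needs no bound: this term is then
  -- nonpositive. Otherwise `hB` applies.
  have h2 : b i * T.gap j x ≤ D * K / r * T.gap i m := by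
    rcases le_or_gt (b i) 0 with hbi | hbi
    · have := mul_nonpos_of_nonpos_of_nonneg hbi hz0
      have : 0 ≤ D * K / r * T.gap i m := mul_nonneg (by positivity) (hm0 i)
      linarith
    · calc b i * T.gap j x ≤ b i * D := mul_le_mul_of_nonneg_left hzD hbi.le
        _ = D / r * (b i * r) := by field_simp
        _ ≤ D / r * (K * T.gap i m) := mul_le_mul_of_nonneg_left (hB i hij) (by positivity)
        _ = _ := by ring
  rw [heq]
  linarith

end ConvexPolytope

/-! ### Barycenters and the consequences of shape regularity -/

namespace ConvexPolytope

variable {d n : ℕ} (T : ConvexPolytope d n)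

/-- The barycenter of a centrally symmetric facet is its center. -/
lemma barycenter_eq_of_symmetric (hd : 2 ≤ d) (j : Fin n) (c : EuclideanSpace ℝ (Fin d))
    (hc : ∀ x ∈ T.facet j, (2 : ℝ) • c - x ∈ T.facet j) : T.barycenter j = c := by
  have := T.isFiniteMeasure_surface hd j
  have := T.neZero_surface hd j
  let R : EuclideanSpace ℝ (Fin d) ≃ᵢ EuclideanSpace ℝ (Fin d) :=
    (AffineIsometryEquiv.pointReflection ℝ c).toIsometryEquiv
  have hR : ∀ x, R x = (2 : ℝ) • c - x := fun x => by
    change (c -ᵥ x) +ᵥ c = _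
    rw [vsub_eq_sub, vadd_eq_add, two_smul]; abel
  have hpre : R ⁻¹' T.facet j = T.facet j := by
    ext x
    rw [Set.mem_preimage, hR]
    refine ⟨fun h => ?_, hc x⟩
    simpa using hc _ h
  have hmp : MeasurePreserving R (T.surface j) (T.surface j) := by
    have := (R.measurePreserving_euclideanHausdorffMeasure (d - 1)).restrict_preimage
      (T.isCompact_facet j).measurableSet
    rwa [hpre] at this
  have h1 : ∫ x, R x ∂(T.surface j) = ∫ x, x ∂(T.surface j) :=
    hmp.integral_comp R.toHomeomorph.measurableEmbedding id
  simp only [hR] at h1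
  have hid : Integrable (fun x => x) (T.surface j) := T.integrable_surface hd j continuous_id
  rw [integral_sub (integrable_const _) hid, integral_const, sub_eq_iff_eq_add] at h1
  have hpos : (T.surface j).real Set.univ ≠ 0 := by
    rw [measureReal_ne_zero_iff]
    exact NeZero.ne _
  have h2 : (2 : ℝ) • ∫ x, x ∂(T.surface j) = (2 : ℝ) • (T.surface j).real Set.univ • c := by
    rw [two_smul, ← h1, smul_comm]
  rw [barycenter, average_eq, smul_right_injective _ (two_ne_zero (α := ℝ)) h2, smul_smul,
    inv_mul_cancel₀ hpos, one_smul]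

/-- For `d = 2` the edge contains the segment of half its length around its barycenter. -/
lemma mem_facet_of_dist_le_of_eq_two (hd : d = 2) {j : Fin n} {y : EuclideanSpace ℝ (Fin d)}
    (hy : T.gap j y = 0) (hyr : dist y (T.barycenter j) ≤ Metric.diam (T.facet j) / 2) :
    y ∈ T.facet j := by
  have hd2 : 2 ≤ d := hd.ge
  obtain ⟨p₀, hp₀⟩ := T.facet_nonempty hd2 j
  -- A longest chord; in dimension 2 its ends are the ends of the edge and its midpoint is the
  -- center of symmetry.
  obtain ⟨a, ha, b, hb, hmax⟩ : ∃ a ∈ T.facet j, ∃ b ∈ T.facet j,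
      ∀ x ∈ T.facet j, ∀ z ∈ T.facet j, dist x z ≤ dist a b := by
    have hK := (T.isCompact_facet j).prod (T.isCompact_facet j)
    obtain ⟨q, hq, hmax⟩ := hK.exists_isMaxOn ⟨(p₀, p₀), Set.mk_mem_prod hp₀ hp₀⟩
      (f := fun p => dist p.1 p.2) continuous_dist.continuousOn
    exact ⟨q.1, hq.1, q.2, hq.2, fun x hx z hz =>
      isMaxOn_iff.1 hmax (x, z) (Set.mk_mem_prod hx hz)⟩
  have hdiam : Metric.diam (T.facet j) ≤ dist a b :=
    Metric.diam_le_of_forall_dist_le dist_nonneg hmax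
  set c := (1 / 2 : ℝ) • (a + b) with hcdef
  have hgc : T.gap j c = 0 := by
    have := T.gap_add_smul_sub j a b (1 / 2)
    rw [(T.mem_facet_iff.1 ha).2, (T.mem_facet_iff.1 hb).2] at this
    rw [hcdef, show (1 / 2 : ℝ) • (a + b) = a + (1 / 2 : ℝ) • (b - a) by module, this]
    simp
  have hmem : ∀ t : ℝ, |t| ≤ 1 / 2 → c + t • (b - a) ∈ T.facet j := by
    intro t ht
    obtain ⟨h1, h2⟩ := abs_le.1 ht
    have : c + t • (b - a) = (1 / 2 - t) • a + (1 / 2 + t) • b := by rw [hcdef]; module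
    rw [this]
    exact T.convex_facet j ha hb (by linarith) (by linarith) (by ring)
  have hline : a ≠ b → ∀ x, T.gap j x = 0 → ∃ t : ℝ, x = c + t • (b - a) := by
    intro hne x hx
    have hrank : Module.finrank ℝ (ℝ ∙ T.normal j)ᗮ = 1 := by
      rw [T.finrank_orthogonal_normal, hd]
    have hv : b - a ∈ (ℝ ∙ T.normal j)ᗮ := by
      rw [Submodule.mem_orthogonal_singleton_iff_inner_right, ← gap_sub_gap,
        (T.mem_facet_iff.1 ha).2, (T.mem_facet_iff.1 hb).2, sub_zero]
    have hx' : x - c ∈ (ℝ ∙ T.normal j)ᗮ := by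
      rw [Submodule.mem_orthogonal_singleton_iff_inner_right, ← gap_sub_gap, hgc, hx, sub_zero]
    obtain ⟨t, ht⟩ := (finrank_eq_one_iff_of_nonzero' (⟨b - a, hv⟩ : (ℝ ∙ T.normal j)ᗮ)
      (by simpa [Subtype.ext_iff, sub_eq_zero] using hne.symm)).1 hrank ⟨x - c, hx'⟩
    refine ⟨t, ?_⟩
    have := congrArg Subtype.val ht
    simp only [Submodule.coe_smul] at this
    rw [this, add_sub_cancel]
  have hnorm : ∀ t : ℝ, ‖t • (b - a)‖ = |t| * dist a b := fun t => by
    rw [norm_smul, Real.norm_eq_abs, dist_comm, dist_eq_norm]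
  have hbary : T.barycenter j = c := by
    refine T.barycenter_eq_of_symmetric hd2 j c fun x hx => ?_
    rcases eq_or_ne a b with rfl | hne
    · have hxa : x = a := dist_le_zero.1 (by simpa using hmax x hx a ha)
      have : (2 : ℝ) • c - x = a := by rw [hxa, hcdef]; module
      rwa [this]
    · obtain ⟨t, rfl⟩ := hline hne x (T.mem_facet_iff.1 hx).2
      have hpos : 0 < dist a b := dist_pos.2 hne
      have h1 := hmax _ hx a ha
      have h2 := hmax _ hx b hb
      rw [dist_eq_norm, show c + t • (b - a) - a = (t + 1 / 2) • (b - a) by rw [hcdef]; module,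
        hnorm] at h1
      rw [dist_eq_norm, show c + t • (b - a) - b = (t - 1 / 2) • (b - a) by rw [hcdef]; module,
        hnorm] at h2
      have h1 := abs_le.1 ((mul_le_iff_le_one_left hpos).1 h1)
      have h2 := abs_le.1 ((mul_le_iff_le_one_left hpos).1 h2)
      rw [show (2 : ℝ) • c - (c + t • (b - a)) = c + (-t) • (b - a) by module]
      exact hmem _ (abs_le.2 ⟨by linarith, by linarith⟩)
  rw [hbary] at hyr
  rcases eq_or_ne a b with rfl | hne
  · rw [dist_self] at hdiam
    have : y = c := dist_le_zero.1 (by linarith)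
    have h0 := hmem 0 (by simp)
    rw [zero_smul, add_zero] at h0
    rwa [this]
  · obtain ⟨t, rfl⟩ := hline hne y hy
    have hpos : 0 < dist a b := dist_pos.2 hne
    rw [dist_self_add_left, hnorm] at hyr
    refine hmem t ?_
    by_contra! h
    have := mul_lt_mul_of_pos_right h hpos
    linarith

lemma diam_carrier_pos (hd : 2 ≤ d) (j : Fin n) : 0 < Metric.diam T.carrier := by
  have hnt : (T.carrier).Nontrivial := by
    obtain ⟨x, hx⟩ := T.exists_forall_gap_pos
    obtain ⟨y, hy⟩ := T.facet_nonempty hd j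
    refine ⟨x, T.mem_carrier_iff.2 fun i => (hx i).le, y, T.facet_subset j hy, ?_⟩
    rintro rfl
    exact (hx j).ne' (T.mem_facet_iff.1 hy).2
  exact Metric.diam_pos hnt T.isBounded

/-- Under shape regularity, `e_j` contains a disk around its barycenter of radius comparable to the
diameter of `T`. -/
lemma IsShapeRegular.mem_facet_of_dist_le {T : ConvexPolytope d n} {j : Fin n} {α₀ ρ σ : ℝ}
    (hT : T.IsShapeRegular j α₀ ρ σ) (hd : d = 2 ∨ d = 3) (hρ : 0 < ρ) (hσ : 0 < σ)
    {y : EuclideanSpace ℝ (Fin d)} (hy : T.gap j y = 0)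
    (hyr : dist y (T.barycenter j) ≤ min σ 1 * ρ / 2 * Metric.diam T.carrier) : y ∈ T.facet j := by
  have hd2 : 2 ≤ d := by omega
  have hh := T.diam_carrier_pos hd2 j
  have hratio := hT.ratio_le j
  have hρh : 0 < ρ * Metric.diam T.carrier := mul_pos hρ hh
  have hy1 : dist y (T.barycenter j) ≤ min σ 1 * (ρ * Metric.diam T.carrier) / 2 := by
    refine hyr.trans_eq ?_; ring
  -- For `d = 2` the half-length of the edge suffices; for `d = 3` the distance from the barycenter
  -- to the neighboring edges is used, and the factor `1/2` makes the inequality strict.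
  rcases hd with hd | hd
  · refine T.mem_facet_of_dist_le_of_eq_two hd hy (hy1.trans ?_)
    have := mul_le_mul_of_nonneg_right (min_le_right σ 1) hρh.le
    linarith
  · refine T.mem_facet_of_dist_lt hd2 (T.barycenter_mem_facet hd2 j)
      (fun i hi => hT.dist_le hd i hi) hy (hy1.trans_lt ?_)
    have h1 := mul_le_mul_of_nonneg_right (min_le_left σ 1) hρh.le
    have h2 := mul_le_mul_of_nonneg_left hratio hσ.le
    have := mul_pos hσ hρh
    linarith

/-- The angle condition bounds the cotangents of the dihedral angles at `e_j`. -/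
lemma IsShapeRegular.abs_inner_le {T : ConvexPolytope d n} {j : Fin n} {α₀ ρ σ : ℝ}
    (hT : T.IsShapeRegular j α₀ ρ σ) (hα : 0 < α₀) (i : Fin n) (hi : T.IsNeighbor j i) :
    |inner ℝ (T.normal j) (T.normal i)| ≤ (Real.sin (min α₀ (Real.pi / 2)))⁻¹ *
      ‖T.normal i - inner ℝ (T.normal j) (T.normal i) • T.normal j‖ := by
  obtain ⟨h1, h2⟩ := hT.angle_le i hi
  set θ := InnerProductGeometry.angle (T.normal j) (T.normal i)
  have hcos : inner ℝ (T.normal j) (T.normal i) = Real.cos θ := by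
    rw [InnerProductGeometry.cos_angle, T.norm_normal, T.norm_normal]; simp
  have hpi := Real.pi_pos
  -- The existence of a neighbor forces `α₀ ≤ π/2`. The minimum in the statement keeps the constant
  -- nonnegative for every `α₀ > 0`, before any `T` is chosen.
  have hmin : min α₀ (Real.pi / 2) = α₀ := min_eq_left (by linarith)
  have hs0 : 0 < Real.sin α₀ := Real.sin_pos_of_pos_of_lt_pi hα (by linarith)
  have hsin : Real.sin α₀ ≤ Real.sin θ := by
    rcases le_total θ (Real.pi / 2) with h | h
    · exact Real.sin_le_sin_of_le_of_le_pi_div_two (by linarith) h h1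
    · rw [← Real.sin_pi_sub θ]
      exact Real.sin_le_sin_of_le_of_le_pi_div_two (by linarith) (by linarith) (by linarith)
  have hnorm : ‖T.normal i - Real.cos θ • T.normal j‖ = Real.sin θ := by
    have hsq : ‖T.normal i - Real.cos θ • T.normal j‖ ^ 2 = Real.sin θ ^ 2 := by
      rw [norm_sub_sq_real, norm_smul, T.norm_normal, T.norm_normal, inner_smul_right,
        real_inner_comm, hcos, Real.norm_eq_abs, mul_one, sq_abs, Real.sin_sq]
      ring
    exact (sq_eq_sq₀ (norm_nonneg _) (hs0.le.trans hsin)).1 hsq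
  rw [hmin, hcos, hnorm, inv_mul_eq_div, le_div_iff₀ hs0]
  calc |Real.cos θ| * Real.sin α₀ ≤ 1 * Real.sin α₀ :=
        mul_le_mul_of_nonneg_right (Real.abs_cos_le_one θ) hs0.le
    _ ≤ Real.sin θ := by rwa [one_mul]

end ConvexPolytope

/-! ### The weights, and existence and uniqueness of the bubble -/

section FacetWeights

variable {d n : ℕ} {T : ConvexPolytope d n} {j : Fin n} {l : Fin n → MvPolynomial (Fin d) ℝ}

/-- `λ_i` is a multiple of `gap i`, and its value 1 at the barycenter both fixes the factor and
rules out `gap i = 0` there. -/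
lemma IsFacetWeights.gap_pos_and_eq (hl : IsFacetWeights T j l) (hd : 2 ≤ d) {i : Fin n}
    (hij : i ≠ j) : 0 < T.gap i (T.barycenter j) ∧
      ∀ x, polyVal (l i) x = T.gap i x / T.gap i (T.barycenter j) := by
  obtain ⟨c, w, hcw⟩ := exists_eq_affinePoly (hl.totalDegree_le i)
  obtain ⟨κ, -, hκ⟩ := T.exists_eq_mul_gap hd (j := i) (c := c) (w := w) fun x hx => by
    rw [← polyVal_affinePoly, ← hcw]; exact hl.vanish i x hx
  simp only [← polyVal_affinePoly, ← hcw] at hκ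
  have h1 := hl.barycenter_eq_one i hij
  rw [hκ] at h1
  have h0 := (T.mem_facet_iff.1 (T.barycenter_mem_facet hd j)).1 i
  refine ⟨h0.lt_of_ne' fun h => by simp [h] at h1, fun x => ?_⟩
  rw [hκ, eq_one_div_of_mul_eq_one_left h1]
  ring

/-- The last bound holds because the maximum 1 is attained at a point of `T`, whose distance to the
hyperplane is at most the diameter. It is what later yields the factor `h²`. -/
lemma IsFacetWeights.exists_eq_mul_gap (hl : IsFacetWeights T j l) (hd : 2 ≤ d) :
    ∃ κ : ℝ, 0 < κ ∧ (∀ x, polyVal (l j) x = κ * T.gap j x) ∧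
      (∀ x, polyDeriv (l j) (T.normal j) x = -κ) ∧ (∀ x ∈ T.carrier, polyVal (l j) x ≤ 1) ∧
      1 ≤ κ * Metric.diam T.carrier := by
  obtain ⟨c, w, hcw⟩ := exists_eq_affinePoly (hl.totalDegree_le j)
  obtain ⟨κ, hw, hκ⟩ := T.exists_eq_mul_gap hd (j := j) (c := c) (w := w) fun x hx => by
    rw [← polyVal_affinePoly, ← hcw]; exact hl.vanish j x hx
  simp only [← polyVal_affinePoly, ← hcw] at hκ
  obtain ⟨x, hx, hx1⟩ := hl.max_eq_one.1
  rw [hκ] at hx1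
  have hgx := T.mem_carrier_iff.1 hx j
  have hκ0 : 0 < κ := by
    by_contra! h
    linarith [mul_nonpos_of_nonpos_of_nonneg h hgx]
  refine ⟨κ, hκ0, hκ, fun y => ?_, fun y hy => hl.max_eq_one.2 ⟨y, hy, rfl⟩, ?_⟩
  · rw [hcw, polyDeriv_affinePoly, hw, real_inner_smul_left, T.inner_normal_self, mul_one]
  · rw [← hx1]
    refine mul_le_mul_of_nonneg_left ?_ hκ0.le
    obtain ⟨y, hy⟩ := T.facet_nonempty hd j
    have h1 := T.gap_sub_gap j x y
    rw [(T.mem_facet_iff.1 hy).2, sub_zero] at h1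
    rw [h1]
    refine (real_inner_le_norm _ _).trans ?_
    rw [T.norm_normal, one_mul, ← dist_eq_norm]
    exact Metric.dist_le_diam_of_mem T.isBounded (T.facet_subset j hy) hx

/-- The product of the squared weights of the facets other than `e_j`. -/
noncomputable def sqWeight (l : Fin n → MvPolynomial (Fin d) ℝ) (j : Fin n) :
    MvPolynomial (Fin d) ℝ := ∏ i ∈ Finset.univ.erase j, l i ^ 2

lemma polyVal_sqWeight (x : EuclideanSpace ℝ (Fin d)) :
    polyVal (sqWeight l j) x = ∏ i ∈ Finset.univ.erase j, polyVal (l i) x ^ 2 := by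
  simp [sqWeight]

lemma polyVal_sqWeight_nonneg (x : EuclideanSpace ℝ (Fin d)) : 0 ≤ polyVal (sqWeight l j) x := by
  rw [polyVal_sqWeight]
  exact Finset.prod_nonneg fun i _ => sq_nonneg _

lemma IsFacetWeights.polyVal_sqWeight_pos (hl : IsFacetWeights T j l) (hd : 2 ≤ d)
    {x : EuclideanSpace ℝ (Fin d)} (hx : ∀ i, i ≠ j → 0 < T.gap i x) :
    0 < polyVal (sqWeight l j) x := by
  rw [polyVal_sqWeight]
  refine Finset.prod_pos fun i hi => ?_
  have hij := Finset.ne_of_mem_erase hi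
  obtain ⟨h1, h2⟩ := hl.gap_pos_and_eq hd hij
  rw [h2]
  exact pow_pos (div_pos (hx i hij) h1) 2

lemma IsFacetWeights.eq_zero_of_integral (hl : IsFacetWeights T j l) (hd : 2 ≤ d)
    {p : MvPolynomial (Fin d) ℝ}
    (h : ∫ x in T.carrier, polyVal (l j ^ 2 * sqWeight l j) x * polyVal p x ^ 2 = 0) : p = 0 := by
  obtain ⟨κ, hκ, hlj, -⟩ := hl.exists_eq_mul_gap hd
  have hU : {x | ∀ i, 0 < T.gap i x} = ⋂ i, {x | 0 < T.gap i x} := by ext; simp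
  refine eq_zero_of_setIntegral_mul_sq_eq_zero T.isCompact_carrier (U := {x | ∀ i, 0 < T.gap i x})
    ?_ T.exists_forall_gap_pos (fun x hx => T.mem_carrier_iff.2 fun i => (hx i).le)
    (continuous_polyVal _) (fun x _ => ?_) (fun x hx => ?_) h
  · rw [hU]
    exact isOpen_iInter_of_finite fun i => isOpen_lt continuous_const (T.continuous_gap i)
  · rw [polyVal_mul, polyVal_pow]
    exact mul_nonneg (sq_nonneg _) (polyVal_sqWeight_nonneg x)
  · rw [polyVal_mul, polyVal_pow, hlj]
    exact mul_pos (pow_pos (mul_pos hκ (hx j)) 2)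
      (hl.polyVal_sqWeight_pos hd fun i _ => hx i)

lemma IsFacetWeights.eq_zero_of_integral_surface (hl : IsFacetWeights T j l) (hd : 2 ≤ d)
    {p : MvPolynomial (Fin d) ℝ}
    (h : ∫ x, polyVal (sqWeight l j) x * polyVal p x ^ 2 ∂(T.surface j) = 0)
    {x : EuclideanSpace ℝ (Fin d)} (hx : T.gap j x = 0) : polyVal p x = 0 :=
  T.polyVal_eq_zero_of_integral_surface hd (continuous_polyVal _)
    (fun x _ => polyVal_sqWeight_nonneg x) (fun _ _ hpos => hl.polyVal_sqWeight_pos hd hpos) h hx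

/-- Division by the weight of `e_j`, with remainder constant along the normal of `e_j`. -/
lemma IsFacetWeights.exists_division (hl : IsFacetWeights T j l) (hd : 2 ≤ d)
    (p : MvPolynomial (Fin d) ℝ) :
    ∃ p₀ s : MvPolynomial (Fin d) ℝ, (s = 0 ∨ s.totalDegree < p.totalDegree) ∧
      p = p₀ + l j * s ∧ ∀ x, polyVal p₀ x = polyVal p (x + T.gap j x • T.normal j) := by
  obtain ⟨κ, hκ, hlj, -⟩ := hl.exists_eq_mul_gap hd
  obtain ⟨p₀, s, -, hs, hp, hv⟩ :=
    -- With this shift vector `x + λ_j(x) t` is the orthogonal projection of `x` onto the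
    -- hyperplane.
    exists_eq_add_affine_mul (hl.totalDegree_le j) (κ⁻¹ • T.normal j) p
  refine ⟨p₀, s, hs, hp, fun x => ?_⟩
  rw [hv, hlj, smul_smul, mul_right_comm, mul_inv_cancel₀ hκ.ne', one_mul]

lemma ConvexPolytope.gap_projection (T : ConvexPolytope d n) (j : Fin n)
    (x : EuclideanSpace ℝ (Fin d)) : T.gap j (x + T.gap j x • T.normal j) = 0 := by
  rw [ConvexPolytope.gap_add, inner_smul_right, T.inner_normal_self, mul_one, sub_self]

lemma polyDeriv_bubble_of_mem_facet (hl : IsFacetWeights T j l) {κ : ℝ}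
    (hκ : ∀ x, polyDeriv (l j) (T.normal j) x = -κ) (r : MvPolynomial (Fin d) ℝ)
    {x : EuclideanSpace ℝ (Fin d)} (hx : x ∈ T.facet j) :
    polyDeriv (l j * sqWeight l j * r) (T.normal j) x
      = -κ * (polyVal (sqWeight l j) x * polyVal r x) := by
  rw [mul_assoc, polyDeriv_mul, hκ, hl.vanish j x hx, polyVal_mul]
  ring

lemma integral_normal_trace (hl : IsFacetWeights T j l) (hd : 2 ≤ d) {κ : ℝ}
    (hκ : ∀ x, polyDeriv (l j) (T.normal j) x = -κ) (r f p : MvPolynomial (Fin d) ℝ) :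
    ∫ x, (polyDeriv (l j * sqWeight l j * r) (T.normal j) x - polyVal f x) * polyVal p x
        ∂(T.surface j)
      = -κ * ∫ x, polyVal (sqWeight l j) x * (polyVal r x * polyVal p x) ∂(T.surface j)
        - ∫ x, polyVal f x * polyVal p x ∂(T.surface j) := by
  rw [← integral_const_mul, ← integral_sub]
  · refine integral_congr_ae ((T.ae_mem_facet j).mono fun x hx => ?_)
    simp only
    rw [polyDeriv_bubble_of_mem_facet hl hκ r hx]
    ring
  · exact T.integrable_surface hd j (by fun_prop)
  · exact T.integrable_surface hd j (by fun_prop)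

/-- Integration against a weight as a linear functional on polynomials. -/
noncomputable def integralFunctional {μ : Measure (EuclideanSpace ℝ (Fin d))}
    (hμ : ∀ g : EuclideanSpace ℝ (Fin d) → ℝ, Continuous g → Integrable g μ)
    (w : MvPolynomial (Fin d) ℝ) : MvPolynomial (Fin d) ℝ →ₗ[ℝ] ℝ where
  toFun p := ∫ x, polyVal w x * polyVal p x ∂μ
  map_add' p q := by
    rw [← integral_add (hμ _ (by fun_prop)) (hμ _ (by fun_prop))]
    exact integral_congr_ae (.of_forall fun x => by simp only [polyVal_add]; ring)
  map_smul' c p := by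
    rw [RingHom.id_apply, smul_eq_mul, ← integral_const_mul]
    exact integral_congr_ae (.of_forall fun x => by simp only [polyVal_smul]; ring)

/-- The two conditions decouple: adding `λ_j s` to `r₀` does not change the trace on `e_j`, so `r₀`
is found from the trace condition and `s` then corrects the moments on `T`. -/
lemma IsFacetWeights.exists_isBubbleSolution (hl : IsFacetWeights T j l) (hd : 2 ≤ d) (k : ℕ)
    (f : MvPolynomial (Fin d) ℝ) : ∃ q, IsBubbleSolution T j l k f q := by
  obtain ⟨κ, hκ, hlj, hder, -⟩ := hl.exists_eq_mul_gap hd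
  have hμs : ∀ g : EuclideanSpace ℝ (Fin d) → ℝ, Continuous g → Integrable g (T.surface j) :=
    fun g hg => T.integrable_surface hd j hg
  have hμT : ∀ g : EuclideanSpace ℝ (Fin d) → ℝ, Continuous g →
      Integrable g (volume.restrict T.carrier) := fun g hg => T.integrable_carrier hg
  obtain ⟨r₀, hr₀, hr₀f⟩ := exists_integral_mul_eq hμs (continuous_polyVal (sqWeight l j)) k
    (-κ⁻¹ • integralFunctional hμs f) (fun p _ hp => by
      have h0 : ∫ x, polyVal f x * polyVal p x ∂(T.surface j) = 0 := by
        rw [← integral_zero (EuclideanSpace ℝ (Fin d)) ℝ (μ := T.surface j)]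
        refine integral_congr_ae ((T.ae_mem_facet j).mono fun x hx => ?_)
        simp only
        rw [hl.eq_zero_of_integral_surface hd hp (T.mem_facet_iff.1 hx).2, mul_zero]
      simp only [LinearMap.smul_apply, integralFunctional, LinearMap.coe_mk, AddHom.coe_mk, h0,
        smul_zero])
  obtain ⟨s, hs, hsp⟩ : ∃ s : MvPolynomial (Fin d) ℝ, (l j * s).totalDegree ≤ k ∧
      ∀ p : MvPolynomial (Fin d) ℝ, p.totalDegree < k →
        ∫ x in T.carrier, polyVal (l j ^ 2 * sqWeight l j) x * (polyVal s x * polyVal p x)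
          = -∫ x in T.carrier, polyVal (l j * sqWeight l j * r₀) x * polyVal p x := by
    -- For `k = 0` there are no moment conditions, and `s = 0` keeps the degree at most `k`.
    rcases k with _ | k
    · exact ⟨0, by simp, fun p hp => absurd hp (Nat.not_lt_zero _)⟩
    · obtain ⟨s, hs, hsp⟩ := exists_integral_mul_eq hμT
        (continuous_polyVal (l j ^ 2 * sqWeight l j)) k
        (-integralFunctional hμT (l j * sqWeight l j * r₀))
        (fun p _ hp => by rw [hl.eq_zero_of_integral hd hp, map_zero])
      refine ⟨s, (MvPolynomial.totalDegree_mul _ _).trans ?_,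
        fun p hp => hsp p (Nat.lt_succ_iff.1 hp)⟩
      have := hl.totalDegree_le j
      omega
  refine ⟨l j * sqWeight l j * (r₀ + l j * s), ⟨_, (MvPolynomial.totalDegree_add _ _).trans
    (max_le hr₀ hs), rfl⟩, fun p hp => ?_, fun p hp => ?_⟩
  · have h1 := hsp p hp
    rw [eq_neg_iff_add_eq_zero, ← integral_add (hμT _ (by fun_prop)) (hμT _ (by fun_prop))] at h1
    rw [← h1]
    refine integral_congr_ae (.of_forall fun x => ?_)
    simp only [polyVal_mul, polyVal_add, polyVal_pow]
    ring
  · have h1 := hr₀f p hp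
    have h2 : ∫ x, polyVal (sqWeight l j) x * (polyVal (r₀ + l j * s) x * polyVal p x)
          ∂(T.surface j)
        = ∫ x, polyVal (sqWeight l j) x * (polyVal r₀ x * polyVal p x) ∂(T.surface j) := by
      refine integral_congr_ae ((T.ae_mem_facet j).mono fun x hx => ?_)
      simp only [polyVal_add, polyVal_mul, hl.vanish j x hx, zero_mul, add_zero]
    rw [integral_normal_trace hl hd hder, h2, h1]
    simp only [LinearMap.smul_apply, integralFunctional, LinearMap.coe_mk, AddHom.coe_mk,
      smul_eq_mul]
    field_simp
    ring

/-- The trace condition tested with `r - r'` makes `r - r'` vanish on the hyperplane of `e_j`.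
Division by `λ_j` then has zero remainder, and testing the moments with the quotient kills the
quotient. -/
lemma IsFacetWeights.isBubbleSolution_unique (hl : IsFacetWeights T j l) (hd : 2 ≤ d) {k : ℕ}
    {f q q' : MvPolynomial (Fin d) ℝ} (hq : IsBubbleSolution T j l k f q)
    (hq' : IsBubbleSolution T j l k f q') : q = q' := by
  obtain ⟨κ, hκ, hlj, hder, -⟩ := hl.exists_eq_mul_gap hd
  obtain ⟨r, hr, hqr⟩ := hq.factor
  obtain ⟨r', hr', hqr'⟩ := hq'.factor
  change q = l j * sqWeight l j * r at hqr
  change q' = l j * sqWeight l j * r' at hqr'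
  have hδ : (r - r').totalDegree ≤ k :=
    (MvPolynomial.totalDegree_sub _ _).trans (max_le hr hr')
  have hplane : ∀ x, T.gap j x = 0 → polyVal (r - r') x = 0 := by
    intro x hx
    refine hl.eq_zero_of_integral_surface hd ?_ hx
    have h1 := hq.normal_trace _ hδ
    have h2 := hq'.normal_trace _ hδ
    rw [hqr, integral_normal_trace hl hd hder] at h1
    rw [hqr', integral_normal_trace hl hd hder] at h2
    have h3 : ∫ x, polyVal (sqWeight l j) x * polyVal (r - r') x ^ 2 ∂(T.surface j)
        = ∫ x, polyVal (sqWeight l j) x * (polyVal r x * polyVal (r - r') x) ∂(T.surface j)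
          - ∫ x, polyVal (sqWeight l j) x * (polyVal r' x * polyVal (r - r') x)
            ∂(T.surface j) := by
      rw [← integral_sub (T.integrable_surface hd j (by fun_prop))
        (T.integrable_surface hd j (by fun_prop))]
      refine integral_congr_ae (.of_forall fun x => ?_)
      simp only [polyVal_sub]
      ring
    rw [h3]
    have h4 : κ * (∫ x, polyVal (sqWeight l j) x * (polyVal r x * polyVal (r - r') x)
        ∂(T.surface j) - ∫ x, polyVal (sqWeight l j) x * (polyVal r' x * polyVal (r - r') x)
            ∂(T.surface j)) = 0 := by linarith
    exact (mul_eq_zero.1 h4).resolve_left hκ.ne'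
  obtain ⟨p₀, s, hs, hδs, hp₀⟩ := hl.exists_division hd (r - r')
  have hp0 : p₀ = 0 := polyVal_injective fun x => by
    rw [hp₀, hplane _ (T.gap_projection j x), polyVal_zero]
  rw [hp0, zero_add] at hδs
  have hs0 : s = 0 := by
    rcases hs with h | h
    · exact h
    have h1 := hq.orthogonal s (h.trans_le hδ)
    have h2 := hq'.orthogonal s (h.trans_le hδ)
    refine hl.eq_zero_of_integral hd ?_
    rw [← sub_eq_zero_of_eq (h1.trans h2.symm), ← integral_sub (T.integrable_carrier (by fun_prop))
      (T.integrable_carrier (by fun_prop))]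
    refine integral_congr_ae (.of_forall fun x => ?_)
    have h3 : polyVal r x - polyVal r' x = polyVal (l j) x * polyVal s x := by
      rw [← polyVal_sub, hδs, polyVal_mul]
    simp only [hqr, hqr', polyVal_mul, polyVal_pow]
    linear_combination (-polyVal (l j) x * polyVal (sqWeight l j) x * polyVal s x) * h3
  rw [hs0, mul_zero, sub_eq_zero] at hδs
  rw [hqr, hqr', hδs]

end FacetWeights

/-! ### The scaled estimate -/

section Estimate

variable {d n : ℕ} {T : ConvexPolytope d n} {j : Fin n} {l : Fin n → MvPolynomial (Fin d) ℝ}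

/-- The point `m + 2 (y - m)` is still in the disk, so the affine function `gap i` is nonnegative
there; at the midpoint `y` it is at least half its value at `m`. -/
lemma IsFacetWeights.one_half_le_of_dist_le (hl : IsFacetWeights T j l) (hd : 2 ≤ d) {r : ℝ}
    (hball : ∀ y, T.gap j y = 0 → dist y (T.barycenter j) ≤ r → y ∈ T.facet j)
    {y : EuclideanSpace ℝ (Fin d)} (hy : T.gap j y = 0)
    (hyr : dist y (T.barycenter j) ≤ r / 2) {i : Fin n} (hij : i ≠ j) :
    1 / 2 ≤ polyVal (l i) y := by
  obtain ⟨hpos, hval⟩ := hl.gap_pos_and_eq hd hij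
  set m := T.barycenter j
  have hm := T.mem_facet_iff.1 (T.barycenter_mem_facet hd j)
  have hmem : m + (2 : ℝ) • (y - m) ∈ T.facet j := by
    refine hball _ (by rw [T.gap_add_smul_sub, hy, hm.2]; simp) ?_
    rw [dist_self_add_left, norm_smul, ← dist_eq_norm, Real.norm_eq_abs, abs_two]
    linarith
  have h1 := (T.mem_facet_iff.1 hmem).1 i
  rw [T.gap_add_smul_sub] at h1
  rw [hval, le_div_iff₀ hpos]
  linarith

lemma IsFacetWeights.le_sqWeight_of_dist_le (hl : IsFacetWeights T j l) (hd : 2 ≤ d) {r : ℝ}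
    (hball : ∀ y, T.gap j y = 0 → dist y (T.barycenter j) ≤ r → y ∈ T.facet j)
    {y : EuclideanSpace ℝ (Fin d)} (hy : T.gap j y = 0)
    (hyr : dist y (T.barycenter j) ≤ r / 2) : (1 / 4 : ℝ) ^ n ≤ polyVal (sqWeight l j) y := by
  rw [polyVal_sqWeight]
  calc (1 / 4 : ℝ) ^ n ≤ (1 / 4 : ℝ) ^ (Finset.univ.erase j).card :=
        pow_le_pow_of_le_one (by norm_num) (by norm_num)
          ((Finset.card_le_univ _).trans_eq (Fintype.card_fin n))
    _ = ∏ _i ∈ Finset.univ.erase j, (1 / 4 : ℝ) := by rw [Finset.prod_const]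
    _ ≤ _ := Finset.prod_le_prod (fun _ _ => by norm_num) fun i hi => by
        have := hl.one_half_le_of_dist_le hd hball hy hyr (Finset.ne_of_mem_erase hi)
        nlinarith

lemma sqWeight_le {M : ℝ} (hM : 1 ≤ M) {x : EuclideanSpace ℝ (Fin d)}
    (h : ∀ i, i ≠ j → polyVal (l i) x ^ 2 ≤ M) : polyVal (sqWeight l j) x ≤ M ^ n := by
  rw [polyVal_sqWeight]
  calc _ ≤ ∏ _i ∈ Finset.univ.erase j, M :=
        Finset.prod_le_prod (fun _ _ => sq_nonneg _) fun i hi => h i (Finset.ne_of_mem_erase hi)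
    _ = M ^ (Finset.univ.erase j).card := by rw [Finset.prod_const]
    _ ≤ M ^ n := pow_le_pow_right₀ hM ((Finset.card_le_univ _).trans_eq (Fintype.card_fin n))

/-- Scaled norm equivalence on the facet: pointwise bounds by the weighted `L²` norm. -/
lemma exists_sq_polyVal_le_integral_surface (d n k : ℕ) (hd : 2 ≤ d) {c : ℝ} (hc : 0 < c) :
    ∃ C : ℝ, 0 ≤ C ∧ ∀ (T : ConvexPolytope d n) (j : Fin n) (l : Fin n → MvPolynomial (Fin d) ℝ)
      (h : ℝ), 0 < h → IsFacetWeights T j l →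
      (∀ y, T.gap j y = 0 → dist y (T.barycenter j) ≤ c * h → y ∈ T.facet j) →
      ∀ p : MvPolynomial (Fin d) ℝ, p.totalDegree ≤ k → ∀ x, T.gap j x = 0 →
        dist x (T.barycenter j) ≤ h →
        h ^ (d - 1) * polyVal p x ^ 2 ≤
          C * ∫ x, polyVal (sqWeight l j) x * polyVal p x ^ 2 ∂(T.surface j) := by
  -- The radius is halved because the weight is bounded below, by `4⁻ⁿ`, only on the half-size disk.
  obtain ⟨C, hC, hCp⟩ := exists_sq_polyVal_le_integral_closedBall (d - 1) k (half_pos hc)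
  refine ⟨C * 4 ^ n, by positivity, fun T j l h hh hl hball p hp x hx hxh => ?_⟩
  set m := T.barycenter j
  have hmf := T.barycenter_mem_facet hd j
  have hm : T.gap j m = 0 := (T.mem_facet_iff.1 hmf).2
  obtain ⟨L, hL⟩ := T.exists_isChart j
  -- Rescaling by `h` turns the disk of radius `h` into the unit ball; the change of variables
  -- produces the power `h ^ (d - 1)`.
  obtain ⟨P, hP, hPv⟩ := exists_polyVal_comp_affine m (h • L.toLinearMap) p
  have hPv' : ∀ y, polyVal P y = polyVal p (m + L (h • y)) := fun y => by
    rw [hPv, map_smul]; rfl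
  obtain ⟨y, rfl⟩ := hL.exists_eq hm hx
  rw [dist_self_add_left, L.norm_map] at hxh
  have h1 := hCp P (hP.trans hp) (h⁻¹ • y) (by
    rw [norm_smul, Real.norm_eq_abs, abs_of_pos (inv_pos.2 hh), inv_mul_le_iff₀ hh, mul_one]
    exact hxh)
  simp only [hPv', smul_smul, mul_inv_cancel₀ hh.ne', one_smul] at h1
  rw [Measure.setIntegral_comp_smul_of_pos volume (fun y => polyVal p (m + L y) ^ 2) _ hh,
    finrank_euclideanSpace_fin, smul_closedBall _ _ (half_pos hc).le, smul_zero, Real.norm_eq_abs,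
    abs_of_pos hh, smul_eq_mul] at h1
  have hcontL : Continuous fun y => m + L y := (ConvexPolytope.isometry_const_add m L).continuous
  have hcont : Continuous fun y => polyVal p (m + L y) ^ 2 := by fun_prop
  have hcontw : Continuous fun y => polyVal (sqWeight l j) (m + L y) * polyVal p (m + L y) ^ 2 := by
    fun_prop
  have hdist : ∀ y ∈ Metric.closedBall (0 : EuclideanSpace ℝ (Fin (d - 1))) (h * (c / 2)),
      dist (m + L y) m ≤ c * h / 2 := fun y hy => by
    rw [dist_self_add_left, L.norm_map]
    rw [mem_closedBall_zero_iff] at hy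
    linarith
  have h2 : (1 / 4 : ℝ) ^ n * ∫ y in Metric.closedBall 0 (h * (c / 2)), polyVal p (m + L y) ^ 2
      ≤ ∫ x, polyVal (sqWeight l j) x * polyVal p x ^ 2 ∂(T.surface j) := by
    rw [hL.integral_surface hm, ← integral_const_mul]
    refine (setIntegral_mono_on ((hcont.const_mul _).continuousOn.integrableOn_compact
      (isCompact_closedBall _ _)) (hcontw.continuousOn.integrableOn_compact
      (isCompact_closedBall _ _)) measurableSet_closedBall fun y hy =>
        mul_le_mul_of_nonneg_right (hl.le_sqWeight_of_dist_le hd hball (hL.gap_eq_zero hm y)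
          (hdist y hy)) (sq_nonneg _)).trans ?_
    refine setIntegral_mono_set (hcontw.continuousOn.integrableOn_compact
      (ConvexPolytope.isCompact_preimage_facet j m L)) (.of_forall fun y =>
        mul_nonneg (polyVal_sqWeight_nonneg _) (sq_nonneg _)) (LE.le.eventuallyLE ?_)
    intro y hy
    refine hball _ (hL.gap_eq_zero hm y) ((hdist y hy).trans ?_)
    have := mul_pos hc hh
    linarith
  calc h ^ (d - 1) * polyVal p (m + L y) ^ 2
      ≤ h ^ (d - 1) * (C * ((h ^ (d - 1))⁻¹ *
          ∫ y in Metric.closedBall 0 (h * (c / 2)), polyVal p (m + L y) ^ 2)) :=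
        mul_le_mul_of_nonneg_left h1 (by positivity)
    _ = C * 4 ^ n * ((1 / 4 : ℝ) ^ n *
          ∫ y in Metric.closedBall 0 (h * (c / 2)), polyVal p (m + L y) ^ 2) := by
        have : (4 : ℝ) ^ n * (1 / 4 : ℝ) ^ n = 1 := by rw [← mul_pow]; norm_num
        have h3 : h ^ (d - 1) ≠ 0 := by positivity
        field_simp
        rw [mul_assoc, this, mul_one]
    _ ≤ _ := mul_le_mul_of_nonneg_left h2 (by positivity)

lemma ConvexPolytope.real_surface_le (T : ConvexPolytope d n) (hd : 2 ≤ d) (j : Fin n) :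
    (T.surface j).real Set.univ ≤ Metric.diam T.carrier ^ (d - 1) *
      volume.real (Metric.closedBall (0 : EuclideanSpace ℝ (Fin (d - 1))) 1) := by
  obtain ⟨L, hL⟩ := T.exists_isChart j
  obtain ⟨m, hm⟩ := T.facet_nonempty hd j
  have hiso := isometry_const_add m L
  rw [hL.surface_eq_map (T.mem_facet_iff.1 hm).2, map_measureReal_apply hiso.continuous.measurable
    MeasurableSet.univ, Set.preimage_univ, measureReal_restrict_apply_univ]
  have := Measure.addHaar_real_closedBall' (volume : Measure (EuclideanSpace ℝ (Fin (d - 1))))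
    0 (r := Metric.diam T.carrier) Metric.diam_nonneg
  rw [finrank_euclideanSpace_fin] at this
  rw [← this]
  refine measureReal_mono (fun y hy => ?_) measure_closedBall_lt_top.ne
  rw [mem_closedBall_zero_iff, ← L.norm_map, ← dist_self_add_left (L y) m]
  exact Metric.dist_le_diam_of_mem T.isBounded (T.facet_subset j hy) (T.facet_subset j hm)

lemma ConvexPolytope.volume_carrier_le (T : ConvexPolytope d n) :
    volume.real T.carrier ≤ Metric.diam T.carrier ^ d *
      volume.real (Metric.closedBall (0 : EuclideanSpace ℝ (Fin d)) 1) := by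
  obtain ⟨m, hm⟩ := T.exists_forall_gap_pos
  have := Measure.addHaar_real_closedBall' (volume : Measure (EuclideanSpace ℝ (Fin d)))
    m (r := Metric.diam T.carrier) Metric.diam_nonneg
  rw [finrank_euclideanSpace_fin] at this
  rw [← this]
  refine measureReal_mono (fun y hy => ?_) measure_closedBall_lt_top.ne
  exact Metric.dist_le_diam_of_mem T.isBounded hy (T.mem_carrier_iff.2 fun i => (hm i).le)

lemma ConvexPolytope.dist_projection_le (T : ConvexPolytope d n) {j : Fin n}
    {m : EuclideanSpace ℝ (Fin d)} (hm : T.gap j m = 0) (x : EuclideanSpace ℝ (Fin d)) :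
    dist (x + T.gap j x • T.normal j) m ≤ dist x m := by
  rw [dist_eq_norm, dist_eq_norm, show x + T.gap j x • T.normal j - m
    = (x - m) + T.gap j x • T.normal j by abel]
  refine (sq_le_sq₀ (norm_nonneg _) (norm_nonneg _)).1 ?_
  have h : inner ℝ (x - m) (T.normal j) = -T.gap j x := by
    rw [real_inner_comm, ← T.gap_sub_gap, hm, zero_sub]
  rw [norm_add_sq_real, inner_smul_right, h, norm_smul, T.norm_normal, Real.norm_eq_abs, mul_one,
    sq_abs]
  nlinarith [sq_nonneg (T.gap j x)]

/-- The bubble solution is bounded in terms of pointwise bounds for the weights and for polynomials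
on the facet. -/
lemma IsBubbleSolution.integral_sq_le {k : ℕ} {f q : MvPolynomial (Fin d) ℝ}
    (hq : IsBubbleSolution T j l k f q) (hl : IsFacetWeights T j l) (hd : 2 ≤ d) {M C : ℝ}
    (hM : ∀ x ∈ T.carrier, polyVal (sqWeight l j) x ≤ M) (hM0 : 0 ≤ M) (hC0 : 0 ≤ C)
    (hC : ∀ p : MvPolynomial (Fin d) ℝ, p.totalDegree ≤ k → ∀ x, T.gap j x = 0 →
        dist x (T.barycenter j) ≤ Metric.diam T.carrier →
        Metric.diam T.carrier ^ (d - 1) * polyVal p x ^ 2 ≤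
          C * ∫ x, polyVal (sqWeight l j) x * polyVal p x ^ 2 ∂(T.surface j)) :
    ∫ x in T.carrier, polyVal q x ^ 2 ≤
      (4 * M ^ 2 * C ^ 2 * volume.real (Metric.closedBall (0 : EuclideanSpace ℝ (Fin d)) 1) *
        volume.real (Metric.closedBall (0 : EuclideanSpace ℝ (Fin (d - 1))) 1)) *
      Metric.diam T.carrier ^ 3 * ∫ x, polyVal f x ^ 2 ∂(T.surface j) := by
  obtain ⟨κ, hκ, hlj, hder, hlj1, hκh⟩ := hl.exists_eq_mul_gap hd
  obtain ⟨r, hr, hqr⟩ := hq.factor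
  change q = l j * sqWeight l j * r at hqr
  have hh := T.diam_carrier_pos hd j
  have hmf := T.barycenter_mem_facet hd j
  set h := Metric.diam T.carrier
  set m := T.barycenter j
  set Ω := volume.real (Metric.closedBall (0 : EuclideanSpace ℝ (Fin d)) 1)
  set ω := volume.real (Metric.closedBall (0 : EuclideanSpace ℝ (Fin (d - 1))) 1)
  have hΩ : 0 ≤ Ω := measureReal_nonneg
  have hω : 0 ≤ ω := measureReal_nonneg
  have hdist : ∀ x ∈ T.carrier, dist x m ≤ h := fun x hx =>
    Metric.dist_le_diam_of_mem T.isBounded hx (T.facet_subset j hmf)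
  have hIs : ∀ g : EuclideanSpace ℝ (Fin d) → ℝ, Continuous g → Integrable g (T.surface j) :=
    fun g hg => T.integrable_surface hd j hg
  have hIT : ∀ g : EuclideanSpace ℝ (Fin d) → ℝ, Continuous g →
      Integrable g (volume.restrict T.carrier) := fun g hg => T.integrable_carrier hg
  set F := ∫ x, polyVal f x ^ 2 ∂(T.surface j)
  set Q := ∫ x, polyVal (sqWeight l j) x * polyVal r x ^ 2 ∂(T.surface j)
  have hF : 0 ≤ F := integral_nonneg fun x => sq_nonneg _
  have hQ : 0 ≤ Q := integral_nonneg fun x => mul_nonneg (polyVal_sqWeight_nonneg x) (sq_nonneg _)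
  have hCr := hC r hr
  have hsurf : ∫ x, polyVal r x ^ 2 ∂(T.surface j) ≤ ω * C * Q := by
    have := T.isFiniteMeasure_surface hd j
    have hpt : ∀ x ∈ T.facet j, polyVal r x ^ 2 ≤ C * Q / h ^ (d - 1) := fun x hx => by
      rw [le_div_iff₀ (by positivity), mul_comm]
      exact hCr x (T.mem_facet_iff.1 hx).2 (hdist x (T.facet_subset j hx))
    calc ∫ x, polyVal r x ^ 2 ∂(T.surface j) ≤ ∫ _x, C * Q / h ^ (d - 1) ∂(T.surface j) :=
          integral_mono_ae (hIs _ (by fun_prop)) (integrable_const _)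
            ((T.ae_mem_facet j).mono hpt)
      _ = (T.surface j).real Set.univ * (C * Q / h ^ (d - 1)) := by
          rw [integral_const, smul_eq_mul]
      _ ≤ (h ^ (d - 1) * ω) * (C * Q / h ^ (d - 1)) :=
          mul_le_mul_of_nonneg_right (T.real_surface_le hd j) (by positivity)
      _ = ω * C * Q := by field_simp
  -- Testing the trace condition with `r` gives `κ Q = -∫ f r`. Cauchy–Schwarz and `hsurf` leave one
  -- factor `Q` to cancel, and `κ h ≥ 1` removes `κ`.
  have hQF : Q ≤ h ^ 2 * (ω * C * F) := by
    have h1 := hq.normal_trace r hr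
    rw [hqr, integral_normal_trace hl hd hder] at h1
    have h2 : ∫ x, polyVal (sqWeight l j) x * (polyVal r x * polyVal r x) ∂(T.surface j) = Q :=
      integral_congr_ae (.of_forall fun x => by simp only; ring)
    rw [h2] at h1
    have h3 : (κ * Q) ^ 2 ≤ F * (ω * C * Q) := by
      rw [show κ * Q = -∫ x, polyVal f x * polyVal r x ∂(T.surface j) by linarith, neg_sq]
      exact (sq_integral_mul_le (hIs _ (by fun_prop)) (hIs _ (by fun_prop))
        (hIs _ (by fun_prop))).trans (mul_le_mul_of_nonneg_left hsurf hF)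
    have h4 : 1 ≤ (κ * h) ^ 2 := one_le_pow₀ hκh
    rcases hQ.eq_or_lt with h0 | h0
    · rw [← h0]; positivity
    · have h5 : κ ^ 2 * Q ≤ ω * C * F := by
        refine le_of_mul_le_mul_right ?_ h0
        linarith
      calc Q ≤ (κ * h) ^ 2 * Q := le_mul_of_one_le_left hQ h4
        _ = h ^ 2 * (κ ^ 2 * Q) := by ring
        _ ≤ _ := mul_le_mul_of_nonneg_left h5 (by positivity)
  obtain ⟨r₀, s, hs, hrs, hr₀⟩ := hl.exists_division hd r
  set R := ∫ x in T.carrier, polyVal (sqWeight l j) x * polyVal r₀ x ^ 2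
  set N := ∫ x in T.carrier, polyVal (l j ^ 2 * sqWeight l j) x * polyVal s x ^ 2
  -- The projection of `T` may leave `e_j` but stays within `h` of the barycenter; this is why the
  -- pointwise bound is assumed on the whole disk of radius `h` in the hyperplane.
  have hR : R ≤ M * Ω * C * h * Q := by
    have hpt : ∀ x ∈ T.carrier, polyVal (sqWeight l j) x * polyVal r₀ x ^ 2
        ≤ M * (C * Q / h ^ (d - 1)) := fun x hx => by
      refine mul_le_mul (hM x hx) ?_ (sq_nonneg _) hM0
      rw [hr₀, le_div_iff₀ (by positivity), mul_comm]
      exact hCr _ (T.gap_projection j x)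
        ((T.dist_projection_le (T.mem_facet_iff.1 hmf).2 x).trans (hdist x hx))
    calc R ≤ ∫ _x in T.carrier, M * (C * Q / h ^ (d - 1)) :=
          setIntegral_mono_on (hIT _ (by fun_prop))
            (integrableOn_const T.isCompact_carrier.measure_ne_top)
            T.isCompact_carrier.measurableSet hpt
      _ = volume.real T.carrier * (M * (C * Q / h ^ (d - 1))) := by
          rw [setIntegral_const, smul_eq_mul]
      _ ≤ (h ^ d * Ω) * (M * (C * Q / h ^ (d - 1))) :=
          mul_le_mul_of_nonneg_right T.volume_carrier_le (by positivity)
      _ = M * Ω * C * h * Q := by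
          obtain ⟨e, rfl⟩ : ∃ e, d = e + 1 := ⟨d - 1, by omega⟩
          rw [Nat.add_sub_cancel, pow_succ]
          field_simp
  -- Orthogonality of `q` to `s` makes the cross term equal to `-N`, so `0 ≤ ∫ b (r₀ + λ_j s)² = R -
  -- N`.
  have hNR : N ≤ R := by
    rcases hs with h0 | hs
    · have : N = 0 := by simp [N, h0]
      rw [this]
      exact integral_nonneg fun x => mul_nonneg (polyVal_sqWeight_nonneg x) (sq_nonneg _)
    have h1 := hq.orthogonal s (hs.trans_le hr)
    have h2 : (0 : ℝ) ≤ ∫ x in T.carrier, (polyVal q x * polyVal s x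
        + (1 / 2 * (polyVal (sqWeight l j) x * polyVal r₀ x ^ 2)
          - 1 / 2 * (polyVal (l j ^ 2 * sqWeight l j) x * polyVal s x ^ 2))) := by
      refine integral_nonneg fun x => ?_
      have : polyVal q x * polyVal s x
          + (1 / 2 * (polyVal (sqWeight l j) x * polyVal r₀ x ^ 2)
            - 1 / 2 * (polyVal (l j ^ 2 * sqWeight l j) x * polyVal s x ^ 2))
          = 1 / 2 * polyVal (sqWeight l j) x *
            (polyVal r₀ x + polyVal (l j) x * polyVal s x) ^ 2 := by
        rw [hqr, hrs]
        simp only [polyVal_mul, polyVal_add, polyVal_pow]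
        ring
      simp only [Pi.zero_apply, this]
      exact mul_nonneg (mul_nonneg (by norm_num) (polyVal_sqWeight_nonneg x)) (sq_nonneg _)
    rw [integral_add (hIT _ (by fun_prop)) (hIT _ (by fun_prop)),
      integral_sub (hIT _ (by fun_prop)) (hIT _ (by fun_prop)), integral_const_mul,
      integral_const_mul, h1] at h2
    linarith
  have hqRN : ∫ x in T.carrier, polyVal q x ^ 2 ≤ 2 * M * (R + N) := by
    rw [← integral_add (hIT _ (by fun_prop)) (hIT _ (by fun_prop)), ← integral_const_mul]
    refine setIntegral_mono_on (hIT _ (by fun_prop)) (hIT _ (by fun_prop))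
      T.isCompact_carrier.measurableSet fun x hx => ?_
    have hb := polyVal_sqWeight_nonneg (l := l) (j := j) x
    have hbM := hM x hx
    have hl0 : 0 ≤ polyVal (l j) x := by
      rw [hlj]; exact mul_nonneg hκ.le (T.mem_carrier_iff.1 hx j)
    have hl2 : polyVal (l j) x ^ 2 ≤ 1 := pow_le_one₀ hl0 (hlj1 x hx)
    rw [hqr, hrs]
    simp only [polyVal_mul, polyVal_add, polyVal_pow]
    generalize polyVal (l j) x = t at *
    generalize polyVal (sqWeight l j) x = b at *
    generalize polyVal r₀ x = u at *
    generalize polyVal s x = v at *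
    calc (t * b * (u + t * v)) ^ 2 = (t ^ 2 * b) * (b * (u + t * v) ^ 2) := by ring
      _ ≤ (1 * M) * (b * (u + t * v) ^ 2) := by
          refine mul_le_mul_of_nonneg_right ?_ (by positivity)
          exact mul_le_mul hl2 hbM hb zero_le_one
      _ ≤ (1 * M) * (b * (2 * u ^ 2 + 2 * (t * v) ^ 2)) := by
          refine mul_le_mul_of_nonneg_left (mul_le_mul_of_nonneg_left ?_ hb) (by linarith)
          nlinarith [sq_nonneg (u - t * v)]
      _ = _ := by ring
  calc ∫ x in T.carrier, polyVal q x ^ 2 ≤ 2 * M * (R + N) := hqRN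
    _ ≤ 2 * M * (2 * (M * Ω * C * h * (h ^ 2 * (ω * C * F)))) := by
        refine mul_le_mul_of_nonneg_left ?_ (by linarith)
        have := mul_le_mul_of_nonneg_left hQF (show 0 ≤ M * Ω * C * h by positivity)
        linarith
    _ = _ := by ring

end Estimate

/-! ### Choice of the constants -/

theorem mainTheorem5 (d n k : ℕ) (hd : d = 2 ∨ d = 3) :
    (∀ (T : ConvexPolytope d n) (j : Fin n) (l : Fin n → MvPolynomial (Fin d) ℝ),
      IsFacetWeights T j l →
      ∀ f : MvPolynomial (Fin d) ℝ, f.totalDegree ≤ k →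
        ∃! q : MvPolynomial (Fin d) ℝ, IsBubbleSolution T j l k f q) ∧
    (∀ α₀ ρ σ : ℝ, 0 < α₀ → 0 < ρ → 0 < σ →
      ∃ C : ℝ, 0 < C ∧
        ∀ (T : ConvexPolytope d n) (j : Fin n) (l : Fin n → MvPolynomial (Fin d) ℝ),
          IsFacetWeights T j l → T.IsShapeRegular j α₀ ρ σ →
          ∀ f q : MvPolynomial (Fin d) ℝ, f.totalDegree ≤ k → IsBubbleSolution T j l k f q →
            polyL2Norm (volume.restrict T.carrier) q ≤
              C * Metric.diam T.carrier ^ (3 / 2 : ℝ) * polyL2Norm (T.surface j) f) := by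
  have hd2 : 2 ≤ d := by omega
  refine ⟨fun T j l hl f _ => ?_, fun α₀ ρ σ hα hρ hσ => ?_⟩
  · obtain ⟨q, hq⟩ := hl.exists_isBubbleSolution hd2 k f
    exact ⟨q, hq, fun q' hq' => hl.isBubbleSolution_unique hd2 hq' hq⟩
  set c : ℝ := min σ 1 * ρ / 2
  have hc : 0 < c := by
    have : 0 < min σ 1 := lt_min hσ one_pos
    positivity
  set K : ℝ := (Real.sin (min α₀ (Real.pi / 2)))⁻¹
  have hK : 0 ≤ K := by
    have hpi := Real.pi_pos
    refine inv_nonneg.2 (Real.sin_nonneg_of_nonneg_of_le_pi (by positivity) ?_)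
    exact (min_le_right _ _).trans (by linarith)
  obtain ⟨C₁, hC₁, hC₁p⟩ := exists_sq_polyVal_le_integral_surface d n k hd2 hc
  -- This is the factor in `gap_le_mul_gap` with `D = h` and `r = c h`; the diameter cancels, so it
  -- does not depend on `T`.
  set A : ℝ := 1 + 1 / c + K / c
  have hA : 1 ≤ A := by
    have : 0 ≤ 1 / c + K / c := by positivity
    simp only [A]; linarith
  set M : ℝ := (A ^ 2) ^ n
  set B : ℝ := 4 * M ^ 2 * C₁ ^ 2 *
    volume.real (Metric.closedBall (0 : EuclideanSpace ℝ (Fin d)) 1) *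
    volume.real (Metric.closedBall (0 : EuclideanSpace ℝ (Fin (d - 1))) 1)
  have hB : 0 ≤ B := by positivity
  -- Adding 1 makes the constant positive without having to show `B > 0`.
  refine ⟨Real.sqrt B + 1, by positivity, fun T j l hl hT f q _ hq => ?_⟩
  have hh := T.diam_carrier_pos hd2 j
  have hmf := T.barycenter_mem_facet hd2 j
  have hball : ∀ y, T.gap j y = 0 → dist y (T.barycenter j) ≤ c * Metric.diam T.carrier →
      y ∈ T.facet j := fun y hy hyr => hT.mem_facet_of_dist_le hd hρ hσ hy hyr
  have hM : ∀ x ∈ T.carrier, polyVal (sqWeight l j) x ≤ M := by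
    intro x hx
    refine sqWeight_le (one_le_pow₀ hA) fun i hij => ?_
    obtain ⟨hpos, hval⟩ := hl.gap_pos_and_eq hd2 hij
    have h1 := T.gap_le_mul_gap (D := Metric.diam T.carrier) hd2 (T.mem_facet_iff.1 hmf).2 (mul_pos hc hh) hK hball
      (hT.abs_inner_le hα) (fun x hx => Metric.dist_le_diam_of_mem T.isBounded hx
        (T.facet_subset j hmf)) hij hx
    have h2 : 1 + Metric.diam T.carrier / (c * Metric.diam T.carrier)
        + Metric.diam T.carrier * K / (c * Metric.diam T.carrier) = A := by
      simp only [A]; field_simp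
    rw [h2] at h1
    rw [hval]
    exact pow_le_pow_left₀ (div_nonneg (T.mem_carrier_iff.1 hx i) hpos.le)
      ((div_le_iff₀ hpos).2 h1) 2
  have hest := hq.integral_sq_le hl hd2 hM (by positivity) hC₁
    (hC₁p T j l _ hh hl hball)
  have hpow : Real.sqrt (Metric.diam T.carrier ^ 3) = Metric.diam T.carrier ^ (3 / 2 : ℝ) := by
    rw [Real.sqrt_eq_rpow, ← Real.rpow_natCast, ← Real.rpow_mul hh.le]
    norm_num
  calc polyL2Norm (volume.restrict T.carrier) q
      ≤ Real.sqrt (B * Metric.diam T.carrier ^ 3 * ∫ x, polyVal f x ^ 2 ∂(T.surface j)) :=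
        Real.sqrt_le_sqrt hest
    _ = Real.sqrt B * Metric.diam T.carrier ^ (3 / 2 : ℝ) * polyL2Norm (T.surface j) f := by
        rw [Real.sqrt_mul (by positivity), Real.sqrt_mul hB, hpow, polyL2Norm]
    _ ≤ _ := by
        refine mul_le_mul_of_nonneg_right (mul_le_mul_of_nonneg_right (by linarith) ?_)
          (Real.sqrt_nonneg _)
        positivity
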